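/- Let $k$ be a field of characteristic $0$, let $q, r, \ell, d \ge 0$ be integers, and let $f_1,\dots,f_\ell \in k[x_1,\dots,x_q,y_1,\dots,y_r]$ be polynomials of total degree at most $d$. Let $0<p<1$ be a real number, and let $S \subset k$ be a finite subset with $$|S| = \left\lceil \frac{d^{\,q+r}}{1-p} \right\rceil .$$ Let $a_1,\dots,a_r$ be independent random variables, each uniformly distributed on $S$ (if $r \ge 1$ this presupposes $S \ne \varnothing$), and let $g_i := f_i|_{y_1=a_1,\dots,y_r=a_r} \in k[x_1,\dots,x_q]$ for $1 \le i \le \ell$. Then, with probability at least $p$, $$\langle f_1,\dots,f_\ell\rangle \cap k[y_1,\dots,y_r] \ne \{0\} \iff 1 \in \langle g_1,\dots,g_\ell\rangle ,$$ where $\langle f_1,\dots,f_\ell\rangle$ is an ideal of $k[x_1,\dots,x_q,y_1,\dots,y_r]$ and $\langle g_1,\dots,g_\ell\rangle$ is an ideal of $k[x_1,\dots,x_q]$. -/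

import Mathlib

/-- The ring `k[x₁, …, x_q, y₁, …, y_r]`: the variable `Sum.inl i` is `x_i` and the variable
`Sum.inr j` is `y_j`. -/
abbrev PolyXY (k : Type*) [CommSemiring k] (q r : ℕ) : Type _ :=
  MvPolynomial (Fin q ⊕ Fin r) k

/-- The subring `k[y₁, …, y_r]` of `k[x₁, …, x_q, y₁, …, y_r]`. -/
noncomputable def polyY (k : Type*) [CommSemiring k] (q r : ℕ) : Subalgebra k (PolyXY k q r) :=
  Algebra.adjoin k (Set.range fun j : Fin r => MvPolynomial.X (Sum.inr j))

/-- The specialization `f ↦ f|_{y₁ = a₁, …, y_r = a_r}`, from `k[x, y]` to `k[x]`. -/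
noncomputable def specializeY {k : Type*} [CommSemiring k] {q r : ℕ} (a : Fin r → k) :
    PolyXY k q r →ₐ[k] MvPolynomial (Fin q) k :=
  MvPolynomial.aeval (Sum.elim MvPolynomial.X fun j => MvPolynomial.C (a j))

/-! Let `I = ⟨f⟩`. It suffices to find a nonzero `h` in `k[y]` of degree at most `d ^ (q + r)` such
that the equivalence holds at every `a` with `h(a) ≠ 0`
(`exists_forall_eval_ne_zero_elimination_iff`). By Schwartz–Zippel, `h` vanishes at a random point
of `S ^ r` with probability at most `deg h / |S| ≤ 1 - p`.

Degree bounds come from the deformation `u_i = F_i + δ x_i ^ d` of a system of `q` polynomials. By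
Nakayama at `δ = ∞`, the monomials `x ^ α` with all `α_i < d` span `k(δ)[x, y]` over `k(δ)[u, y]`,
with no loss of degree (`wDeg_le_reducedSpan`). Multiplication by a polynomial is thus given by a
matrix of size `d ^ q` with controlled entries. Its characteristic polynomial, normalized and taken
at `δ = 0`, gives Perron's theorem and the relations used below.

If `I` meets `k[y]` nontrivially, any nonzero `h` in `I ∩ k[y]` works, because `h(a)` is then a unit
in `⟨g⟩`. To bound its degree, adjoin a variable `t` and put `K = k(y)`. The elements `t f_j` and
`x_i` generate `K[t, x]`, so `q + 1` suitable `k`-combinations `u` of them form a Noether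
normalization. Perron's theorem over `k(t)` yields an irreducible relation between `u` and `y` over
`k[t]`, of degree at most `d ^ (q + 1)` in `y`. Since `t` is integral over `K[u]`, its leading
coefficient in `t` is some `h` in `k[y]`. Modulo `I` each `t f_j` vanishes, so `u` becomes free of
`t` and every `t`-coefficient of the relation vanishes; hence `h ∈ I`.

If `I ∩ k[y] = 0`, then `⟨g⟩` must be proper for `a` off a hypersurface of degree at most `d ^ q`.
If some `I ∩ k[x_i, y]` is zero, `x_i` is made a parameter and one inducts. Otherwise `I` is
zero-dimensional over `k(y)`, and a zero of it is an isolated zero of `q` generic combinations `F`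
of the `f_j`. The deformation of `F` gives an equation for the linear form `∑ s_i x_i` with generic
`s`, of joint degree at most `d ^ q` in the form and `y`, still valid at this zero for `δ = 0`.
Where its leading coefficient does not vanish at `a`, the coordinates of the zero are integral over
the local ring of `y = a`, so the zero specializes to a zero of `g`. -/

open MvPolynomial

/-! ### Weighted degree bounds for polynomials and determinants -/

section WeightedDegree

variable {ι ι' : Type*} {R R' : Type*} [CommRing R] [CommRing R']

/-- Polynomials all of whose monomials have `w`-weight at most `b - a` (as integers). -/
noncomputable def wDeg (R : Type*) [CommRing R] (w : ι → ℕ) (a b : ℕ) :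
    Submodule R (MvPolynomial ι R) :=
  restrictSupport R {m | Finsupp.weight w m + a ≤ b}

theorem mem_wDeg {w : ι → ℕ} {a b : ℕ} {p : MvPolynomial ι R} :
    p ∈ wDeg R w a b ↔ ∀ m ∈ p.support, Finsupp.weight w m + a ≤ b := Iff.rfl

theorem monomial_mem_wDeg {w : ι → ℕ} {a b : ℕ} {m : ι →₀ ℕ} (c : R)
    (h : Finsupp.weight w m + a ≤ b) : monomial m c ∈ wDeg R w a b :=
  (monomial_mem_restrictSupport R).2 (Or.inl h)

theorem wDeg_mono {w : ι → ℕ} {a b a' b' : ℕ} (h : a' + b ≤ a + b') :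
    wDeg R w a b ≤ wDeg R w a' b' :=
  restrictSupport_mono R fun m hm => by
    simp only [Set.mem_ofPred_eq] at hm ⊢
    omega

theorem mul_mem_wDeg {w : ι → ℕ} {a b a' b' : ℕ} {p q : MvPolynomial ι R}
    (hp : p ∈ wDeg R w a b) (hq : q ∈ wDeg R w a' b') :
    p * q ∈ wDeg R w (a + a') (b + b') := by
  classical
  intro m hm
  obtain ⟨x, hx, y, hy, rfl⟩ := Finset.mem_add.1 (support_mul p q hm)
  have := hp hx
  have := hq hy
  simp only [Set.mem_ofPred_eq, map_add] at *
  omega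

theorem mul_mem_wDeg_zero {w : ι → ℕ} {b b' : ℕ} {p q : MvPolynomial ι R}
    (hp : p ∈ wDeg R w 0 b) (hq : q ∈ wDeg R w 0 b') : p * q ∈ wDeg R w 0 (b + b') :=
  wDeg_mono (by omega) (mul_mem_wDeg hp hq)

theorem C_mem_wDeg {w : ι → ℕ} (c : R) : (C c : MvPolynomial ι R) ∈ wDeg R w 0 0 :=
  monomial_mem_wDeg c (by simp)

theorem one_mem_wDeg {w : ι → ℕ} : (1 : MvPolynomial ι R) ∈ wDeg R w 0 0 :=
  C_mem_wDeg 1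

theorem X_mem_wDeg {w : ι → ℕ} (i : ι) : (X i : MvPolynomial ι R) ∈ wDeg R w 0 (w i) :=
  monomial_mem_wDeg 1 (by simp [Finsupp.weight_single])

theorem prod_mem_wDeg {β : Type*} {w : ι → ℕ} (s : Finset β) {a b : β → ℕ}
    {p : β → MvPolynomial ι R} (hp : ∀ i ∈ s, p i ∈ wDeg R w (a i) (b i)) :
    ∏ i ∈ s, p i ∈ wDeg R w (∑ i ∈ s, a i) (∑ i ∈ s, b i) := by
  classical
  induction s using Finset.induction_on with
  | empty => simpa using one_mem_wDeg
  | insert i s hi ih =>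
    rw [Finset.prod_insert hi, Finset.sum_insert hi, Finset.sum_insert hi]
    exact mul_mem_wDeg (hp i (by simp)) (ih fun j hj => hp j (by simp [hj]))

theorem pow_mem_wDeg {w : ι → ℕ} {b : ℕ} {p : MvPolynomial ι R} (hp : p ∈ wDeg R w 0 b) (n : ℕ) :
    p ^ n ∈ wDeg R w 0 (n * b) := by
  simpa using prod_mem_wDeg (Finset.range n) (a := fun _ => 0) (b := fun _ => b) (p := fun _ => p)
    (fun _ _ => hp)

theorem map_mem_wDeg {w : ι → ℕ} {a b : ℕ} (φ : R →+* R') {p : MvPolynomial ι R}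
    (hp : p ∈ wDeg R w a b) : map φ p ∈ wDeg R' w a b :=
  fun _ hm => hp (support_map_subset φ p hm)

theorem eval₂_mem_wDeg {w : ι → ℕ} {w' : ι' → ℕ} (φ : R →+* R') {g : ι → MvPolynomial ι' R'}
    (hg : ∀ i, g i ∈ wDeg R' w' 0 (w i)) {a b : ℕ} {p : MvPolynomial ι R}
    (hp : p ∈ wDeg R w a b) : eval₂ (C.comp φ) g p ∈ wDeg R' w' a b := by
  rw [eval₂_eq]
  refine Submodule.sum_mem _ fun m hm => ?_
  have h1 : ∏ i ∈ m.support, g i ^ m i ∈ wDeg R' w' 0 (Finsupp.weight w m) := by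
    have := prod_mem_wDeg m.support (a := fun _ => 0) (b := fun i => m i * w i)
      (p := fun i => g i ^ m i) (fun i _ => pow_mem_wDeg (hg i) (m i))
    simpa [Finsupp.weight_apply, Finsupp.sum] using this
  have h2 := mul_mem_wDeg (C_mem_wDeg (w := w') (φ (p.coeff m))) h1
  refine wDeg_mono ?_ h2
  have := hp hm
  simp only [Set.mem_ofPred_eq] at this
  omega

theorem aeval_mem_wDeg {w : ι → ℕ} {w' : ι' → ℕ} {g : ι → MvPolynomial ι' R}
    (hg : ∀ i, g i ∈ wDeg R w' 0 (w i)) {a b : ℕ} {p : MvPolynomial ι R}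
    (hp : p ∈ wDeg R w a b) : aeval g p ∈ wDeg R w' a b := by
  have := eval₂_mem_wDeg (RingHom.id R) hg hp
  rwa [RingHom.comp_id] at this

theorem mem_wDeg_one_iff {b : ℕ} {p : MvPolynomial ι R} :
    p ∈ wDeg R (fun _ => 1) 0 b ↔ p.totalDegree ≤ b := by
  rw [mem_wDeg, totalDegree, Finset.sup_le_iff]
  simp [Finsupp.weight_apply]

/-- A matrix whose `(i, j)` entry has degree at most `e + c i - c j` has a determinant of degree
at most `e` times its size. -/
theorem det_mem_wDeg {A : Type*} [Fintype A] [DecidableEq A] {w : ι → ℕ} {c : A → ℕ} {e : ℕ}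
    {N : Matrix A A (MvPolynomial ι R)} (hN : ∀ i j, N i j ∈ wDeg R w (c j) (e + c i)) :
    N.det ∈ wDeg R w 0 (e * Fintype.card A) := by
  rw [Matrix.det_apply]
  refine Submodule.sum_mem _ fun π _ => ?_
  rw [Units.smul_def]
  refine zsmul_mem ?_ _
  -- Along a permutation the shifts `c` have the same total over rows and over columns, so they
  -- cancel and each factor contributes only `e`.
  refine wDeg_mono ?_ (prod_mem_wDeg Finset.univ fun i _ => hN (π i) i)
  rw [Finset.sum_add_distrib, Equiv.sum_comp π c]
  simp [mul_comm, add_comm]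

end WeightedDegree

/-! ### Spanning by reduced monomials over a local ring -/

section Spanning

variable {σ τ : Type} [Fintype σ] [DecidableEq σ]

/-- The polynomials of total degree at most `n` that can be written as
`∑ α, M α (u, y) x ^ α` with exponents below `d` and the expected degree bounds. -/
noncomputable def reducedSpan {O : Type*} [CommRing O] (d n : ℕ)
    (u : σ → MvPolynomial (σ ⊕ τ) O) : Submodule O (MvPolynomial (σ ⊕ τ) O) :=
  (Submodule.pi Set.univ fun α : σ → Fin d =>
    wDeg O (Sum.elim (fun _ : σ => d) fun _ : τ => 1) (∑ i, (α i : ℕ)) n).map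
  (∑ α : σ → Fin d, (LinearMap.mulRight O (∏ i, X (Sum.inl i) ^ (α i : ℕ))).comp
    ((aeval (Sum.elim u (X ∘ Sum.inr))).toLinearMap.comp (LinearMap.proj α)))

theorem mem_reducedSpan {O : Type*} [CommRing O] {d n : ℕ}
    {u : σ → MvPolynomial (σ ⊕ τ) O} {p : MvPolynomial (σ ⊕ τ) O} :
    p ∈ reducedSpan d n u ↔ ∃ M : (σ → Fin d) → MvPolynomial (σ ⊕ τ) O,
      (∀ α, M α ∈ wDeg O (Sum.elim (fun _ : σ => d) fun _ : τ => 1) (∑ i, (α i : ℕ)) n) ∧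
      p = ∑ α, aeval (Sum.elim u (X ∘ Sum.inr)) (M α) * ∏ i, X (Sum.inl i) ^ (α i : ℕ) := by
  simp only [reducedSpan, Submodule.mem_map, Submodule.mem_pi, Set.mem_univ, true_imp_iff]
  refine exists_congr fun M => and_congr_right fun _ => ?_
  simp [LinearMap.sum_apply, eq_comm]

theorem wDeg_one_fg {ι O : Type*} [Finite ι] [CommRing O] (n : ℕ) :
    (wDeg O (fun _ : ι => 1) 0 n).FG := by
  rw [wDeg, restrictSupport_eq_span]
  refine Submodule.fg_span (Set.Finite.image _ ?_)
  refine (Finsupp.finite_of_degree_le (σ := ι) n).subset fun m hm => ?_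
  simp only [Set.mem_ofPred_eq, add_zero] at hm ⊢
  rwa [Finsupp.degree_eq_weight_one]

/-- Two polynomials of degree at most `n` that agree up to `ε` times such a polynomial. -/
def CongrDeg {ι O : Type*} [CommRing O] (ε : O) (n : ℕ) (p q : MvPolynomial ι O) : Prop :=
  q ∈ wDeg O (fun _ => 1) 0 n ∧ ∃ c ∈ wDeg O (fun _ => 1) 0 n, p = q + ε • c

namespace CongrDeg

variable {ι O : Type*} [CommRing O] {ε : O}

theorem refl {n : ℕ} {p : MvPolynomial ι O} (hp : p ∈ wDeg O (fun _ => 1) 0 n) :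
    CongrDeg ε n p p :=
  ⟨hp, 0, zero_mem _, by simp⟩

theorem mul {n n' : ℕ} {p q p' q' : MvPolynomial ι O} (h : CongrDeg ε n p q)
    (h' : CongrDeg ε n' p' q') : CongrDeg ε (n + n') (p * p') (q * q') := by
  obtain ⟨hq, c, hc, rfl⟩ := h
  obtain ⟨hq', c', hc', rfl⟩ := h'
  have h1 := mul_mem_wDeg_zero hc hq'
  have h2 := mul_mem_wDeg_zero hq hc'
  have h3 := Submodule.smul_mem _ ε (mul_mem_wDeg_zero hc hc')
  refine ⟨mul_mem_wDeg_zero hq hq', _, add_mem (add_mem h1 h2) h3, ?_⟩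
  simp only [Algebra.smul_def]
  ring

theorem pow {n : ℕ} {p q : MvPolynomial ι O} (h : CongrDeg ε n p q) (m : ℕ) :
    CongrDeg ε (m * n) (p ^ m) (q ^ m) := by
  induction m with
  | zero => simpa using refl one_mem_wDeg
  | succ m ih => simpa [pow_succ, Nat.succ_mul] using ih.mul h

theorem prod {β : Type*} (s : Finset β) {n : β → ℕ} {p q : β → MvPolynomial ι O}
    (h : ∀ i ∈ s, CongrDeg ε (n i) (p i) (q i)) :
    CongrDeg ε (∑ i ∈ s, n i) (∏ i ∈ s, p i) (∏ i ∈ s, q i) := by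
  classical
  induction s using Finset.induction_on with
  | empty => simpa using refl one_mem_wDeg
  | insert i s hi ih =>
    rw [Finset.prod_insert hi, Finset.prod_insert hi, Finset.sum_insert hi]
    exact (h i (by simp)).mul (ih fun j hj => h j (by simp [hj]))

end CongrDeg

/-- Modulo `ε` each `u i` is `x_i ^ d`, and division of exponents by `d` writes every monomial in
the required form. Nakayama lifts this to `O`; it applies because the polynomials of degree at most
`n` form a finitely generated module, which is also why the degree bound survives. -/
theorem wDeg_le_reducedSpan [Fintype τ] {O : Type*} [CommRing O] [IsLocalRing O] {ε : O}
    (hε : ε ∈ IsLocalRing.maximalIdeal O) {d : ℕ} (hd : 0 < d) {F : σ → MvPolynomial (σ ⊕ τ) O}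
    (hF : ∀ i, F i ∈ wDeg O (fun _ => 1) 0 d) (n : ℕ) :
    wDeg O (fun _ => 1) 0 n ≤ reducedSpan d n fun i => X (Sum.inl i) ^ d + ε • F i := by
  refine Submodule.le_of_le_smul_of_le_jacobson_bot (I := IsLocalRing.maximalIdeal O)
    (wDeg_one_fg n) (IsLocalRing.maximalIdeal_le_jacobson ⊥) ?_
  conv_lhs => rw [wDeg, restrictSupport_eq_span]
  rw [Submodule.span_le]
  rintro _ ⟨m, hm, rfl⟩
  simp only [Set.mem_ofPred_eq, add_zero] at hm
  set u : σ → MvPolynomial (σ ⊕ τ) O := fun i => X (Sum.inl i) ^ d + ε • F i with hu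
  have hX : ∀ i : σ ⊕ τ, (X i : MvPolynomial (σ ⊕ τ) O) ∈ wDeg O (fun _ => 1) 0 1 :=
    fun i => X_mem_wDeg i
  have hsum : Finsupp.weight (fun _ : σ ⊕ τ => 1) m =
      ∑ i, m (Sum.inl i) + ∑ j, m (Sum.inr j) := by
    simp [Finsupp.weight_apply, Finsupp.sum_fintype, Fintype.sum_sum_type]
  have hdm : ∀ i, m (Sum.inl i) / d * d + m (Sum.inl i) % d = m (Sum.inl i) := fun i =>
    Nat.div_add_mod' _ _
  let γ : σ ⊕ τ →₀ ℕ := Finsupp.equivFunOnFinite.symm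
    (Sum.elim (fun i => m (Sum.inl i) / d) fun j => m (Sum.inr j))
  let α : σ → Fin d := fun i => ⟨m (Sum.inl i) % d, Nat.mod_lt _ hd⟩
  -- The monomial `m` with each full block `x_i ^ d` replaced by `u i`. It lies in the span by
  -- construction and differs from `m` by `ε` times a polynomial of no larger degree.
  let E : MvPolynomial (σ ⊕ τ) O :=
    ((∏ i, u i ^ (m (Sum.inl i) / d)) * ∏ j, X (Sum.inr j) ^ m (Sum.inr j)) *
      ∏ i, X (Sum.inl i) ^ (m (Sum.inl i) % d)
  have hE : E ∈ reducedSpan d n u := by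
    classical
    refine mem_reducedSpan.2 ⟨Pi.single α (monomial γ 1), fun β => ?_, ?_⟩
    · rcases eq_or_ne β α with rfl | hβ
      · rw [Pi.single_eq_same]
        refine monomial_mem_wDeg _ (le_trans (le_of_eq ?_) hm)
        rw [hsum, Finsupp.weight_apply, Finsupp.sum_fintype _ _ (by simp), Fintype.sum_sum_type]
        simp only [γ, α, Finsupp.coe_equivFunOnFinite_symm, Sum.elim_inl, Sum.elim_inr,
          smul_eq_mul, mul_one]
        rw [← Finset.sum_congr rfl fun i _ => hdm i, Finset.sum_add_distrib]
        ring
      · rw [Pi.single_eq_of_ne hβ]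
        exact zero_mem _
    · rw [Finset.sum_eq_single α]
      · rw [Pi.single_eq_same, aeval_monomial]
        simp [E, γ, α, Finsupp.prod_fintype, Fintype.prod_sum_type]
      · intro β _ hβ
        simp [Pi.single_eq_of_ne hβ]
      · simp
  have hc : CongrDeg ε (Finsupp.weight (fun _ : σ ⊕ τ => 1) m) E (monomial m 1) := by
    have h1 : CongrDeg ε (∑ i, m (Sum.inl i) / d * d) (∏ i, u i ^ (m (Sum.inl i) / d))
        (∏ i, (X (Sum.inl i) ^ d : MvPolynomial (σ ⊕ τ) O) ^ (m (Sum.inl i) / d)) := by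
      refine CongrDeg.prod _ fun i _ => CongrDeg.pow ⟨?_, F i, hF i, rfl⟩ _
      simpa using pow_mem_wDeg (hX (Sum.inl i)) d
    have h2 : CongrDeg ε (∑ j, m (Sum.inr j)) (∏ j : τ, X (Sum.inr j) ^ m (Sum.inr j))
        (∏ j : τ, (X (Sum.inr j) : MvPolynomial (σ ⊕ τ) O) ^ m (Sum.inr j)) :=
      CongrDeg.prod _ fun j _ => CongrDeg.refl (by simpa using pow_mem_wDeg (hX (Sum.inr j)) _)
    have h3 : CongrDeg ε (∑ i, m (Sum.inl i) % d) (∏ i : σ, X (Sum.inl i) ^ (m (Sum.inl i) % d))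
        (∏ i : σ, (X (Sum.inl i) : MvPolynomial (σ ⊕ τ) O) ^ (m (Sum.inl i) % d)) :=
      CongrDeg.prod _ fun j _ => CongrDeg.refl (by simpa using pow_mem_wDeg (hX (Sum.inl j)) _)
    have h := (h1.mul h2).mul h3
    have e1 : ∑ i, m (Sum.inl i) / d * d + ∑ j, m (Sum.inr j) + ∑ i, m (Sum.inl i) % d =
        Finsupp.weight (fun _ : σ ⊕ τ => 1) m := by
      rw [hsum, ← Finset.sum_congr rfl fun i _ => hdm i, Finset.sum_add_distrib]
      ring
    have e2 : (∏ i, (X (Sum.inl i) ^ d : MvPolynomial (σ ⊕ τ) O) ^ (m (Sum.inl i) / d)) *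
        (∏ j : τ, (X (Sum.inr j) : MvPolynomial (σ ⊕ τ) O) ^ m (Sum.inr j)) *
        (∏ i : σ, (X (Sum.inl i) : MvPolynomial (σ ⊕ τ) O) ^ (m (Sum.inl i) % d)) =
        monomial m 1 := by
      rw [monomial_eq, Finsupp.prod_fintype _ _ (by simp), Fintype.prod_sum_type, mul_right_comm,
        ← Finset.prod_mul_distrib]
      simp only [← pow_mul, ← pow_add, Nat.div_add_mod, C_1, one_mul]
    rwa [e1, e2] at h
  obtain ⟨-, c, hc, hEc⟩ := hc
  have : (monomial m 1 : MvPolynomial (σ ⊕ τ) O) = E + -(ε • c) := by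
    rw [hEc]; ring
  rw [SetLike.mem_coe]
  change monomial m 1 ∈ _
  rw [this]
  refine Submodule.add_mem_sup hE (neg_mem (Submodule.smul_mem_smul hε (wDeg_mono ?_ hc)))
  omega

end Spanning

/-! ### Multiplication matrices for the deformed system -/

section Engine

variable {σ τ : Type} [Fintype σ] [DecidableEq σ] [Fintype τ]

/-- The deformation `F i + δ x_i ^ d` of the polynomials `F i`, over `k(δ)`. -/
noncomputable def deform {k : Type*} [Field k] (d : ℕ) (F : σ → MvPolynomial (σ ⊕ τ) k) (i : σ) :
    MvPolynomial (σ ⊕ τ) (RatFunc k) :=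
  map RatFunc.C (F i) + (RatFunc.X : RatFunc k) • X (Sum.inl i) ^ d

/-- The spanning result applies over the valuation ring of `k(δ)` at infinity, where `ε = δ⁻¹` lies
in the maximal ideal: `δ⁻¹ (F i + δ x_i ^ d) = x_i ^ d + ε F i`. -/
theorem exists_eq_sum_deform {k : Type*} [Field k] {d : ℕ} (hd : 0 < d)
    {F : σ → MvPolynomial (σ ⊕ τ) k} (hF : ∀ i, (F i).totalDegree ≤ d)
    {p : MvPolynomial (σ ⊕ τ) k} {n : ℕ} (hp : p.totalDegree ≤ n) :
    ∃ M : (σ → Fin d) → MvPolynomial (σ ⊕ τ) (RatFunc k),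
      (∀ α, M α ∈ wDeg (RatFunc k) (Sum.elim (fun _ : σ => d) fun _ : τ => 1)
        (∑ i, (α i : ℕ)) n) ∧
      map RatFunc.C p = ∑ α, aeval (Sum.elim (deform d F) (X ∘ Sum.inr)) (M α) *
        ∏ i, X (Sum.inl i) ^ (α i : ℕ) := by
  classical
  let O := (RatFunc.inftyValuation k).valuationSubring
  have hX : RatFunc.inftyValuation k (RatFunc.X) = WithZero.exp 1 := RatFunc.inftyValuation.X k
  have hC : ∀ c : k, RatFunc.C c ∈ O := fun c => by
    rw [Valuation.mem_valuationSubring_iff]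
    rcases eq_or_ne c 0 with rfl | hc
    · simp
    · rw [RatFunc.inftyValuation.C k hc]
  have hXinv : (RatFunc.X : RatFunc k)⁻¹ ∈ O := by
    rw [Valuation.mem_valuationSubring_iff, map_inv₀, hX, ← WithZero.exp_neg, ← WithZero.exp_zero,
      WithZero.exp_le_exp]
    norm_num
  let φ : k →+* O := RingHom.codRestrict RatFunc.C O hC
  let ψ : O →+* RatFunc k := O.subtype
  have hψφ : ψ.comp φ = RatFunc.C := rfl
  let ε : O := ⟨_, hXinv⟩
  have hε : ε ∈ IsLocalRing.maximalIdeal O := by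
    rw [IsLocalRing.mem_maximalIdeal, mem_nonunits_iff]
    intro h
    obtain ⟨b, hb⟩ := h.exists_right_inv
    have hb' : (RatFunc.X : RatFunc k)⁻¹ * (b : RatFunc k) = 1 := congrArg Subtype.val hb
    have hbX : (b : RatFunc k) = RatFunc.X := by
      rwa [inv_mul_eq_one₀ RatFunc.X_ne_zero, eq_comm] at hb'
    have := (Valuation.mem_valuationSubring_iff _ _).1 b.2
    rw [hbX, hX, ← WithZero.exp_zero, WithZero.exp_le_exp] at this
    norm_num at this
  have hp' : map φ p ∈ wDeg O (fun _ => 1) 0 n := map_mem_wDeg φ (mem_wDeg_one_iff.2 hp)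
  obtain ⟨M, hM, hpM⟩ := mem_reducedSpan.1 (wDeg_le_reducedSpan hε hd
    (F := fun i => map φ (F i)) (fun i => map_mem_wDeg φ (mem_wDeg_one_iff.2 (hF i))) n hp')
  -- Rescaling by `δ⁻¹` turns a polynomial in `x_i ^ d + ε F i` into one in `F i + δ x_i ^ d`.
  let g : σ ⊕ τ → MvPolynomial (σ ⊕ τ) (RatFunc k) :=
    Sum.elim (fun i => C (RatFunc.X : RatFunc k)⁻¹ * X (Sum.inl i)) (X ∘ Sum.inr)
  have hg : ∀ i, g i ∈ wDeg (RatFunc k) (Sum.elim (fun _ : σ => d) fun _ : τ => 1) 0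
      (Sum.elim (fun _ : σ => d) (fun _ : τ => 1) i) := by
    rintro (i | j)
    · exact wDeg_mono (by simp) (mul_mem_wDeg (C_mem_wDeg (RatFunc.X : RatFunc k)⁻¹)
        (X_mem_wDeg (w := Sum.elim (fun _ : σ => d) fun _ : τ => 1) (Sum.inl i)))
    · exact X_mem_wDeg (w := Sum.elim (fun _ : σ => d) fun _ : τ => 1) (Sum.inr j)
  refine ⟨fun α => eval₂ (C.comp ψ) g (M α), fun α => eval₂_mem_wDeg ψ hg (hM α), ?_⟩
  rw [← hψφ, ← map_map, hpM, map_sum]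
  refine Finset.sum_congr rfl fun α _ => ?_
  rw [map_mul, map_prod]
  simp only [map_pow, map_X]
  congr 1
  have key : (map ψ).comp (aeval (Sum.elim (fun i => X (Sum.inl i) ^ d + ε • (map φ) (F i))
      (X ∘ Sum.inr : τ → MvPolynomial (σ ⊕ τ) O))).toRingHom =
      (aeval (Sum.elim (deform d F) (X ∘ Sum.inr))).toRingHom.comp (eval₂Hom (C.comp ψ) g) := by
    refine ringHom_ext (fun c => by simp) ?_
    rintro (i | j)
    · have h1 : (C ((RatFunc.X : RatFunc k)⁻¹) : MvPolynomial (σ ⊕ τ) (RatFunc k)) *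
          C RatFunc.X = 1 := by
        rw [← C_mul, inv_mul_cancel₀ RatFunc.X_ne_zero, C_1]
      have h2 : ψ ε = (RatFunc.X : RatFunc k)⁻¹ := rfl
      simp only [AlgHom.toRingHom_eq_coe, RingHom.coe_comp, RingHom.coe_coe, Function.comp_apply,
        aeval_X, Sum.elim_inl, map_add, map_pow, map_X, smul_eq_C_mul, map_mul, map_C, map_map,
        hψφ, h2, coe_eval₂Hom, eval₂_X, g, deform, algHom_C, algebraMap_eq, mul_add]
      rw [← mul_assoc, h1]
      ring
    · simp [g]
  exact RingHom.congr_fun key (M α)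

/-- Multiplication by a polynomial in terms of the remainders modulo a deformed system. -/
theorem exists_mulMatrix {k : Type*} [Field k] {d : ℕ} (hd : 0 < d)
    {F : σ → MvPolynomial (σ ⊕ τ) k} (hF : ∀ i, (F i).totalDegree ≤ d)
    {p : MvPolynomial (σ ⊕ τ) k} {e : ℕ} (hp : p.totalDegree ≤ e) :
    ∃ M : Matrix (σ → Fin d) (σ → Fin d) (MvPolynomial (σ ⊕ τ) (RatFunc k)),
      (∀ α β, M α β ∈ wDeg (RatFunc k) (Sum.elim (fun _ : σ => d) fun _ : τ => 1)
        (∑ i, (β i : ℕ)) (e + ∑ i, (α i : ℕ))) ∧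
      ∀ α, map RatFunc.C p * ∏ i, X (Sum.inl i) ^ (α i : ℕ) =
        ∑ β, aeval (Sum.elim (deform d F) (X ∘ Sum.inr)) (M α β) *
          ∏ i, X (Sum.inl i) ^ (β i : ℕ) := by
  have key : ∀ α : σ → Fin d, (p * ∏ i, X (Sum.inl i) ^ (α i : ℕ)).totalDegree ≤
      e + ∑ i, (α i : ℕ) := fun α => by
    refine (totalDegree_mul _ _).trans (add_le_add hp ((totalDegree_finsetProd _ _).trans ?_))
    exact Finset.sum_le_sum fun i _ => by simp [totalDegree_X_pow]
  choose M hM hMp using fun α => exists_eq_sum_deform hd hF (key α)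
  exact ⟨M, hM, fun α => by simpa using hMp α⟩

/-- Multiplying by the adjugate gives `det N • v = 0`. The entry `1` of `v` replaces the hypothesis
that the ring is a domain, since the lemma is also applied in a quotient ring. -/
theorem det_eq_zero_of_sum_eq {A R : Type*} [Fintype A] [DecidableEq A] [CommRing R]
    {N : Matrix A A R} {v : A → R} {a : A} (hv : v a = 1) (h : N.mulVec v = 0) : N.det = 0 := by
  have h1 : N.adjugate.mulVec (N.mulVec v) = N.det • v := by
    rw [Matrix.mulVec_mulVec, Matrix.adjugate_mul, Matrix.smul_mulVec, Matrix.one_mulVec]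
  rw [h, Matrix.mulVec_zero] at h1
  simpa [hv] using (congrFun h1 a).symm

end Engine

/-! ### Clearing denominators in the deformation parameter -/

section ClearDenominators

variable {ι : Type*} {k : Type*} [Field k]

theorem exists_C_mul_eq_map {A K : Type*} [CommRing A] [IsDomain A] [Field K] [Algebra A K]
    [IsFractionRing A K] (p : MvPolynomial ι K) :
    ∃ c : A, c ≠ 0 ∧ ∃ p' : MvPolynomial ι A, C (algebraMap A K c) * p = map (algebraMap A K) p' := by
  classical
  obtain ⟨⟨c, hc⟩, h⟩ := IsLocalization.exist_integer_multiples_of_finset (nonZeroDivisors A)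
    (p.support.image fun m => p.coeff m)
  refine ⟨c, nonZeroDivisors.ne_zero hc, ?_⟩
  suffices h' : C (algebraMap A K c) * p ∈ (map (algebraMap A K) : MvPolynomial ι A →+* _).range by
    obtain ⟨p', hp'⟩ := h'
    exact ⟨p', hp'.symm⟩
  rw [p.as_sum, Finset.mul_sum]
  refine sum_mem fun m hm => ?_
  obtain ⟨b, hb⟩ := h (p.coeff m) (Finset.mem_image_of_mem _ hm)
  refine ⟨monomial m b, ?_⟩
  rw [map_monomial, C_mul_monomial, hb, Algebra.smul_def]

/-- After clearing denominators, the largest power of `δ` dividing all coefficients is removed; what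
remains is nonzero at `δ = 0`. This is how relations over `k(δ)` are passed to the limit. -/
theorem exists_C_mul_eq_map_of_ne_zero {p : MvPolynomial ι (RatFunc k)} (hp : p ≠ 0) :
    ∃ c : RatFunc k, c ≠ 0 ∧ ∃ p' : MvPolynomial ι (Polynomial k),
      C c * p = map (algebraMap (Polynomial k) (RatFunc k)) p' ∧
      map (Polynomial.evalRingHom 0) p' ≠ 0 := by
  obtain ⟨c, hc, p₁, hp₁⟩ := exists_C_mul_eq_map (A := Polynomial k) p
  have hinj := IsFractionRing.injective (Polynomial k) (RatFunc k)
  have hc' : algebraMap (Polynomial k) (RatFunc k) c ≠ 0 := by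
    rwa [Ne, FaithfulSMul.algebraMap_eq_zero_iff]
  have hp₁0 : p₁ ≠ 0 := by
    rintro rfl
    rw [map_zero] at hp₁
    exact mul_ne_zero (by simpa using hc') hp hp₁
  -- Induction on the degree of one fixed nonzero coefficient, which drops with every division by
  -- `δ`.
  have hmain : ∀ n : ℕ, ∀ p₁ : MvPolynomial ι (Polynomial k), p₁ ≠ 0 →
      ∀ m, p₁.coeff m ≠ 0 → (p₁.coeff m).natDegree ≤ n →
      ∃ j : ℕ, ∃ p', p₁ = C (Polynomial.X ^ j) * p' ∧
        map (Polynomial.evalRingHom 0) p' ≠ 0 := by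
    intro n
    induction n with
    | zero =>
      intro p₁ _ m hm hmn
      refine ⟨0, p₁, by simp, fun h0 => hm ?_⟩
      have := congrArg (coeff m) h0
      rw [coeff_map, coeff_zero, Polynomial.eq_C_of_natDegree_le_zero hmn] at this
      rw [Polynomial.eq_C_of_natDegree_le_zero hmn]
      simpa using this
    | succ n ih =>
      intro p₁ hp₁ m hm hmn
      by_cases h0 : map (Polynomial.evalRingHom 0) p₁ = 0
      · have hdvd : C (Polynomial.X : Polynomial k) ∣ p₁ := by
          rw [C_dvd_iff_dvd_coeff]
          intro m
          have := congrArg (coeff m) h0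
          rw [coeff_map, coeff_zero] at this
          rw [Polynomial.X_dvd_iff, Polynomial.coeff_zero_eq_eval_zero]
          exact this
        obtain ⟨p₂, rfl⟩ := hdvd
        rw [coeff_C_mul] at hm hmn
        have hm2 := right_ne_zero_of_mul hm
        rw [Polynomial.natDegree_X_mul hm2] at hmn
        obtain ⟨j, p', rfl, hp'⟩ := ih p₂ (right_ne_zero_of_mul hp₁) m hm2 (by omega)
        exact ⟨j + 1, p', by rw [pow_succ', C_mul, mul_assoc], hp'⟩
      · exact ⟨0, p₁, by simp, h0⟩
  obtain ⟨m, hm⟩ := exists_coeff_ne_zero hp₁0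
  obtain ⟨j, p', rfl, hp'⟩ := hmain _ p₁ hp₁0 m hm le_rfl
  refine ⟨(RatFunc.X ^ j)⁻¹ * algebraMap _ _ c,
    mul_ne_zero (inv_ne_zero (pow_ne_zero _ RatFunc.X_ne_zero)) hc', p', ?_, hp'⟩
  rw [C_mul, mul_assoc, hp₁, map_mul, map_C, map_pow, RatFunc.algebraMap_X, ← mul_assoc, ← C_mul,
    inv_mul_cancel₀ (pow_ne_zero _ RatFunc.X_ne_zero), C_1, one_mul]

end ClearDenominators

/-! ### Perron's theorem -/

section Perron

variable {σ τ : Type}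

/-- The deformation `F i + δ x_i ^ d`, over `k[δ]`. -/
noncomputable def deformPoly {k : Type*} [Field k] (d : ℕ) (F : σ → MvPolynomial (σ ⊕ τ) k)
    (i : σ) : MvPolynomial (σ ⊕ τ) (Polynomial k) :=
  map Polynomial.C (F i) + C Polynomial.X * X (Sum.inl i) ^ d

theorem map_deformPoly {k : Type*} [Field k] (d : ℕ) (F : σ → MvPolynomial (σ ⊕ τ) k) (i : σ) :
    map (algebraMap (Polynomial k) (RatFunc k)) (deformPoly d F i) = deform d F i := by
  have : (algebraMap (Polynomial k) (RatFunc k)).comp Polynomial.C = RatFunc.C := by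
    ext c
    simp
  simp [deformPoly, deform, map_map, this, smul_eq_C_mul]

theorem map_evalRingHom_zero_deformPoly {k : Type*} [Field k] (d : ℕ)
    (F : σ → MvPolynomial (σ ⊕ τ) k) (i : σ) :
    map (Polynomial.evalRingHom 0) (deformPoly d F i) = F i := by
  have : (Polynomial.evalRingHom (0 : k)).comp Polynomial.C = RingHom.id k := by
    ext c
    simp
  simp [deformPoly, map_map, this, map_id]

theorem map_aeval_eq {ι ι' A B : Type*} [CommRing A] [CommRing B] (φ : A →+* B)
    (g : ι → MvPolynomial ι' A) (p : MvPolynomial ι A) :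
    map φ (aeval g p) = aeval (fun i => map φ (g i)) (map φ p) := by
  have : (map φ).comp (aeval g).toRingHom =
      (aeval (fun i => map φ (g i))).toRingHom.comp (map φ : MvPolynomial ι A →+* _) := by
    refine ringHom_ext (fun c => by simp) fun i => by simp
  exact RingHom.congr_fun this p

theorem wDeg_of_C_mul_eq_map {ι A K : Type*} [CommRing A] [Field K] {φ : A →+* K}
    (hφ : Function.Injective φ) {w : ι → ℕ} {a b : ℕ} {c : K} {p : MvPolynomial ι K}
    {p' : MvPolynomial ι A} (hp : p ∈ wDeg K w a b) (h : C c * p = map φ p') :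
    p' ∈ wDeg A w a b := by
  have h1 : map φ p' ∈ wDeg K w a b := by
    rw [← h, ← smul_eq_C_mul]
    exact Submodule.smul_mem _ _ hp
  rw [mem_wDeg] at h1 ⊢
  rwa [support_map_of_injective _ hφ] at h1

theorem rename_mem_wDeg {ι ι' R : Type*} [CommRing R] {w : ι → ℕ} {w' : ι' → ℕ} (f : ι → ι')
    (hf : ∀ i, w' (f i) = w i) {a b : ℕ} {p : MvPolynomial ι R} (hp : p ∈ wDeg R w a b) :
    rename f p ∈ wDeg R w' a b := by
  have h : rename f = aeval (R := R) fun i => (X (f i) : MvPolynomial ι' R) := by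
    ext i : 1
    simp
  rw [h]
  exact aeval_mem_wDeg (fun i => by rw [← hf]; exact X_mem_wDeg (f i)) hp

/-- **Perron's theorem**: `F i` (`i ∈ σ`), `G` and the variables `y_j` satisfy a relation of
weighted degree at most `deg G * d ^ #σ`. -/
theorem exists_perron_relation [Fintype σ] [DecidableEq σ] [Fintype τ]
    {k : Type*} [Field k] {d : ℕ} (hd : 0 < d)
    {F : σ → MvPolynomial (σ ⊕ τ) k} (hF : ∀ i, (F i).totalDegree ≤ d)
    {G : MvPolynomial (σ ⊕ τ) k} {e : ℕ} (hG : G.totalDegree ≤ e) :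
    ∃ W : MvPolynomial (Option (σ ⊕ τ)) k, W ≠ 0 ∧
      W ∈ wDeg k (fun o => o.elim e (Sum.elim (fun _ : σ => d) fun _ : τ => 1)) 0
        (e * d ^ Fintype.card σ) ∧
      aeval (fun o : Option (σ ⊕ τ) => o.elim G (Sum.elim F (X ∘ Sum.inr))) W = 0 := by
  classical
  obtain ⟨M, hM, hMG⟩ := exists_mulMatrix hd hF hG
  let w : Option (σ ⊕ τ) → ℕ := fun o => o.elim e (Sum.elim (fun _ : σ => d) fun _ : τ => 1)
  -- `N = T - M`, where `T` stands for `G` and the variables of `M` for the deformed system and `y`.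
  -- Its determinant is the relation sought.
  let N : Matrix (σ → Fin d) (σ → Fin d) (MvPolynomial (Option (σ ⊕ τ)) (RatFunc k)) :=
    Matrix.diagonal (fun _ => X none) - M.map (rename some)
  have hN : ∀ α β, N α β ∈ wDeg (RatFunc k) w (∑ i, (β i : ℕ)) (e + ∑ i, (α i : ℕ)) := by
    intro α β
    refine sub_mem ?_ ?_
    · rcases eq_or_ne α β with rfl | h
      · rw [Matrix.diagonal_apply_eq]
        exact wDeg_mono (by simp [w, add_comm]) (X_mem_wDeg (w := w) none)
      · rw [Matrix.diagonal_apply_ne _ h]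
        exact zero_mem _
    · rw [Matrix.map_apply]
      exact rename_mem_wDeg some (fun _ => rfl) (hM α β)
  have hdet : N.det ∈ wDeg (RatFunc k) w 0 (e * d ^ Fintype.card σ) := by
    simpa using det_mem_wDeg hN
  -- As a polynomial in `T` the determinant is the characteristic polynomial of `M`, which is monic.
  have hdet0 : N.det ≠ 0 := by
    intro h0
    let θ : MvPolynomial (Option (σ ⊕ τ)) (RatFunc k) →ₐ[RatFunc k]
        Polynomial (MvPolynomial (σ ⊕ τ) (RatFunc k)) :=
      aeval fun o => o.elim Polynomial.X fun i => Polynomial.C (X i)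
    have hθ : ∀ p : MvPolynomial (σ ⊕ τ) (RatFunc k), θ (rename some p) = Polynomial.C p := by
      intro p
      have : (θ.comp (rename some)) = Polynomial.CAlgHom.comp
          (AlgHom.id (RatFunc k) (MvPolynomial (σ ⊕ τ) (RatFunc k))) := by
        ext i
        simp [θ]
      exact DFunLike.congr_fun this p
    have h1 : θ N.det = M.charpoly := by
      rw [AlgHom.map_det, Matrix.charpoly]
      congr 1
      ext1 α β
      by_cases h : α = β
      · subst h
        simp [N, hθ, θ, Matrix.charmatrix_apply_eq]
      · simp [N, hθ, h]
    rw [h0, map_zero] at h1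
    exact M.charpoly_monic.ne_zero h1.symm
  let ev : MvPolynomial (Option (σ ⊕ τ)) (RatFunc k) →ₐ[RatFunc k] MvPolynomial (σ ⊕ τ) (RatFunc k) :=
    aeval fun o => o.elim (map RatFunc.C G) (Sum.elim (deform d F) (X ∘ Sum.inr))
  -- After substitution the vector of the monomials `x ^ α` lies in the kernel of `N`, and its entry
  -- at `α = 0` is `1`.
  have hev : ev N.det = 0 := by
    rw [AlgHom.map_det]
    refine det_eq_zero_of_sum_eq (v := fun α => ∏ i, X (Sum.inl i) ^ (α i : ℕ))
      (a := fun _ => ⟨0, hd⟩) (by simp) ?_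
    ext1 α
    have h1 : ∀ p : MvPolynomial (σ ⊕ τ) (RatFunc k), ev (rename some p) =
        aeval (Sum.elim (deform d F) (X ∘ Sum.inr)) p := fun p => by
      simp only [ev, aeval_rename]
      rfl
    have h2 : ev (X none) = map RatFunc.C G := by simp [ev]
    simp only [Matrix.mulVec, dotProduct, AlgHom.mapMatrix_apply, Matrix.map_apply,
      Matrix.sub_apply, map_sub, N, h1, sub_mul, Finset.sum_sub_distrib, Pi.zero_apply]
    rw [← hMG α, Finset.sum_eq_single α]
    · rw [Matrix.diagonal_apply_eq, h2, sub_self]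
    · intro β _ h
      rw [Matrix.diagonal_apply_ne _ h.symm, map_zero, zero_mul]
    · simp
  obtain ⟨c, hc, W, hW, hW0⟩ := exists_C_mul_eq_map_of_ne_zero hdet0
  have hinj := IsFractionRing.injective (Polynomial k) (RatFunc k)
  refine ⟨_, hW0, map_mem_wDeg _ (wDeg_of_C_mul_eq_map hinj hdet hW), ?_⟩
  let g : Option (σ ⊕ τ) → MvPolynomial (σ ⊕ τ) (Polynomial k) := fun o =>
    o.elim (map Polynomial.C G) (Sum.elim (deformPoly d F) (X ∘ Sum.inr))
  have hg : aeval g W = 0 := by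
    apply map_injective _ hinj
    rw [map_zero, map_aeval_eq, ← hW]
    have : (fun i => map (algebraMap (Polynomial k) (RatFunc k)) (g i)) =
        fun o => o.elim (map RatFunc.C G) (Sum.elim (deform d F) (X ∘ Sum.inr)) := by
      have hC : (algebraMap (Polynomial k) (RatFunc k)).comp Polynomial.C = RatFunc.C := by
        ext c
        simp
      funext o
      rcases o with _ | i | j
      · simp [g, map_map, hC]
      · simp [g, map_deformPoly]
      · simp [g]
    rw [this]
    change ev _ = 0
    rw [map_mul, hev, mul_zero]
  have h3 := map_aeval_eq (Polynomial.evalRingHom (0 : k)) g W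
  rw [hg, map_zero] at h3
  rw [h3]
  congr 2
  funext o
  have hC : (Polynomial.evalRingHom (0 : k)).comp Polynomial.C = RingHom.id k := by
    ext c
    simp
  rcases o with _ | i | j
  · simp [g, map_map, hC, map_id]
  · simp [g, map_evalRingHom_zero_deformPoly]
  · simp [g]

end Perron

/-! ### Heights, generic elements and persistence of isolated zeros -/

section Heights

/-- Induction on the number of variables: over a Jacobson ring a maximal ideal of the polynomial
ring contracts to a maximal ideal, and its height exceeds that of the contraction by one. -/
theorem height_eq_card_of_isMaximal {K σ : Type*} [Field K] [Finite σ]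
    (m : Ideal (MvPolynomial σ K)) [m.IsMaximal] : m.height = Nat.card σ := by
  revert m
  induction σ using Finite.induction_empty_option with
  | of_equiv e H =>
    intro m hm
    let f := (renameEquiv K e).toRingEquiv
    have : (m.comap f).IsMaximal := Ideal.comap_isMaximal_of_equiv f
    rw [← Nat.card_congr e, ← H (m.comap f)]
    exact (f.height_comap m).symm
  | h_empty =>
    intro m hm
    have : m = ⊥ := by
      let f := (isEmptyRingEquiv K PEmpty).symm
      have : (m.comap f).IsMaximal := Ideal.comap_isMaximal_of_equiv f
      have h := Ideal.eq_bot_of_prime (m.comap f)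
      rw [eq_bot_iff]
      intro x hx
      have : f.symm x ∈ m.comap f := by
        rw [Ideal.mem_comap, RingEquiv.apply_symm_apply]
        exact hx
      rw [h, Ideal.mem_bot] at this
      simpa using this
    rw [this, Ideal.height_bot]
    simp
  | @h_option α _ H =>
    intro m hm
    let f := (optionEquivLeft K α).symm.toRingEquiv
    have hmax : (m.comap f).IsMaximal := Ideal.comap_isMaximal_of_equiv f
    have h1 := f.height_comap m
    have hmax' : ((m.comap f).comap (Polynomial.C : MvPolynomial α K →+* _)).IsMaximal :=
      Polynomial.isMaximal_comap_C_of_isJacobsonRing _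
    have : (m.comap f).LiesOver ((m.comap f).comap (Polynomial.C : MvPolynomial α K →+* _)) := ⟨rfl⟩
    have h2 := Polynomial.height_eq_height_add_one
      ((m.comap f).comap (Polynomial.C : MvPolynomial α K →+* _)) (m.comap f)
    rw [← h1, h2, H]
    simp

/-- Generic elements of a subspace `W` cut out an ideal of the expected height away from the
zeros of `W`. -/
theorem exists_seq_mem_forall_minimalPrimes {k R : Type*} [Field k] [Infinite k] [CommRing R]
    [IsNoetherianRing R] [Algebra k R] (W : Submodule k R) (n : ℕ) :
    ∃ F : Fin n → R, (∀ i, F i ∈ W) ∧ ∀ Q ∈ (Ideal.span (Set.range F)).minimalPrimes,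
      (W : Set R) ⊆ Q ∨ (n : ℕ∞) ≤ Q.height := by
  classical
  induction n with
  | zero => exact ⟨Fin.elim0, fun i => i.elim0, fun Q _ => Or.inr (by simp)⟩
  | succ n ih =>
    obtain ⟨F, hFW, hF⟩ := ih
    have hfin := (Ideal.span (Set.range F)).finite_minimalPrimes_of_isNoetherianRing
    let T : Finset (Ideal R) := hfin.toFinset.filter fun Q => ¬ (W : Set R) ⊆ Q
    -- Each `Q` in `T` meets `W` in a proper subspace, and a vector space over an infinite field is
    -- not a finite union of proper subspaces.
    have hx : ∃ x ∈ W, ∀ Q ∈ T, x ∉ Q := by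
      by_contra! hcon
      let s : Finset (Subspace k W) := T.image fun Q => (Q.restrictScalars k).comap W.subtype
      have htop : ⊤ ∉ s := by
        intro h
        obtain ⟨Q, hQ, hQW⟩ := Finset.mem_image.1 h
        refine (Finset.mem_filter.1 hQ).2 fun x hx => ?_
        have : (⟨x, hx⟩ : W) ∈ (Q.restrictScalars k).comap W.subtype := hQW ▸ Submodule.mem_top
        exact this
      refine Subspace.biUnion_ne_univ_of_top_notMem htop (Set.eq_univ_of_forall fun x => ?_)
      obtain ⟨Q, hQ, hxQ⟩ := hcon x x.2
      exact Set.mem_biUnion (Finset.mem_image_of_mem _ hQ) hxQ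
    obtain ⟨x, hxW, hxT⟩ := hx
    refine ⟨Fin.cons x F, fun i => Fin.cases hxW hFW i, fun Q' hQ' => ?_⟩
    have hQ'p : Q'.IsPrime := hQ'.1.1
    have hle : Ideal.span (Set.range (Fin.cons x F : Fin (n + 1) → R)) ≤ Q' := hQ'.1.2
    rw [Fin.range_cons, Ideal.span_le, Set.insert_subset_iff] at hle
    obtain ⟨Q, hQ, hQQ'⟩ := Ideal.exists_minimalPrimes_le (Ideal.span_le.2 hle.2)
    have hQp : Q.IsPrime := hQ.1.1
    rcases em ((W : Set R) ⊆ Q) with hW | hW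
    · exact Or.inl (hW.trans hQQ')
    · refine Or.inr ?_
      have hnQ := (hF Q hQ).resolve_left hW
      have hxQ : x ∉ Q := hxT Q (Finset.mem_filter.2 ⟨hfin.mem_toFinset.2 hQ, hW⟩)
      have hlt : Q < Q' := lt_of_le_of_ne hQQ' fun h => hxQ (h ▸ hle.1)
      have := Ideal.height_add_one_le_of_lt_of_isPrime hlt
      push_cast
      exact (add_le_add_left hnQ 1).trans this

/-- Isolated zeros persist under deformation: if the maximal ideal `m`, of height at least `#σ`,
is minimal over `(F i)`, then a polynomial vanishing on the deformed system `F i + δ g i`, up to a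
factor in `δ` alone, vanishes at `m` for `δ = 0`. -/
theorem eval_zero_mem_of_isolated {R σ : Type*} [CommRing R] [IsNoetherianRing R] [Fintype σ]
    {m : Ideal R} [m.IsMaximal] (hm : (Fintype.card σ : ℕ∞) ≤ m.height) {F : σ → R}
    (hF : m ∈ (Ideal.span (Set.range F)).minimalPrimes) (g : σ → R) {e ψ : Polynomial R} {j : ℕ}
    (he : e.eval 0 ∉ m)
    (h : Polynomial.X ^ j * e * ψ ∈
      Ideal.span (Set.range fun i => Polynomial.C (F i) + Polynomial.X * Polynomial.C (g i))) :
    ψ.eval 0 ∈ m := by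
  -- `M = (m, δ)` has height at least `#σ + 1`, while by Krull a minimal prime of the `#σ` deformed
  -- equations has height at most `#σ`.
  let M : Ideal (Polynomial R) := m.comap (Polynomial.evalRingHom 0)
  have hmemM : ∀ p : Polynomial R, p ∈ M ↔ p.eval 0 ∈ m := fun p => Iff.rfl
  have hM : M.IsMaximal := Ideal.comap_isMaximal_of_surjective _
    fun r => ⟨Polynomial.C r, by simp⟩
  have hlies : M.LiesOver m := ⟨by
    ext r
    simp [Ideal.under, hmemM]⟩
  have hheight := Polynomial.height_eq_height_add_one m M
  have hFm : ∀ i, F i ∈ m := fun i => hF.1.2 (Ideal.subset_span ⟨i, rfl⟩)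
  set J := Ideal.span (Set.range fun i =>
    Polynomial.C (F i) + Polynomial.X * Polynomial.C (g i)) with hJ
  have hJM : J ≤ M := by
    rw [hJ, Ideal.span_le]
    rintro _ ⟨i, rfl⟩
    simpa [hmemM] using hFm i
  obtain ⟨Q, hQ, hQM⟩ := Ideal.exists_minimalPrimes_le hJM
  have hQp : Q.IsPrime := hQ.1.1
  have hQh : Q.height ≤ Fintype.card σ := by
    refine (Ideal.height_le_card_of_mem_minimalPrimes_span (Set.finite_range _) hQ).trans ?_
    rw [← Set.image_univ]
    have := Set.ncard_image_le (f := fun i => Polynomial.C (F i) + Polynomial.X * Polynomial.C (g i))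
      (Set.finite_univ (α := σ))
    rw [Set.ncard_univ, Nat.card_eq_fintype_card] at this
    exact_mod_cast this
  -- If `δ ∈ Q`, then `Q` contains all `F i`, hence contains `m` by minimality, hence contains `M`,
  -- against the heights. So the component `Q` through `M` is not contained in `δ = 0`.
  have hX : (Polynomial.X : Polynomial R) ∉ Q := by
    intro hX
    have hcomap : m ≤ Q.comap Polynomial.C := by
      refine hF.2 ⟨Ideal.comap_isPrime _ _, ?_⟩ fun r hr => ?_
      · rw [Ideal.span_le]
        rintro _ ⟨i, rfl⟩
        have h1 : Polynomial.C (F i) + Polynomial.X * Polynomial.C (g i) ∈ Q :=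
          hQ.1.2 (Ideal.subset_span ⟨i, rfl⟩)
        exact (Q.add_mem_iff_left (Q.mul_mem_right _ hX)).1 h1
      · simpa [hmemM] using hQM hr
    have hMQ : M ≤ Q := by
      intro p hp
      rw [← Polynomial.X_mul_divX_add p]
      refine Q.add_mem (Q.mul_mem_right _ hX) (hcomap ?_)
      rw [Polynomial.coeff_zero_eq_eval_zero]
      exact hp
    have hM' := (Ideal.height_mono hMQ).trans hQh
    rw [hheight] at hM'
    have h2 := (add_le_add_left hm 1).trans hM'
    norm_cast at h2
    omega
  have heQ : e ∉ Q := fun h' => he (hQM h')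
  rcases hQp.mem_or_mem (hQ.1.2 h) with h1 | h1
  · rcases hQp.mem_or_mem h1 with h2 | h2
    · exact absurd (hQp.mem_of_pow_mem _ h2) hX
    · exact absurd h2 heQ
  · exact hQM h1

end Heights

/-! ### Passing between `k[x, y]` and `k(y)[x]` -/

section Localization

theorem exists_C_mul_mem_span {A K ι β : Type*} [CommRing A] [IsDomain A] [Field K] [Algebra A K]
    [IsFractionRing A K] {f : β → MvPolynomial ι A} {g : MvPolynomial ι A}
    (h : map (algebraMap A K) g ∈ Ideal.span (Set.range fun i => map (algebraMap A K) (f i))) :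
    ∃ c : A, c ≠ 0 ∧ C c * g ∈ Ideal.span (Set.range f) := by
  let _ : Algebra (MvPolynomial ι A) (MvPolynomial ι K) := algebraMvPolynomial
  have hmap : ∀ p : MvPolynomial ι A,
      algebraMap (MvPolynomial ι A) (MvPolynomial ι K) p = map (algebraMap A K) p := fun _ => rfl
  have h' : algebraMap (MvPolynomial ι A) (MvPolynomial ι K) g ∈
      Ideal.map (algebraMap (MvPolynomial ι A) (MvPolynomial ι K)) (Ideal.span (Set.range f)) := by
    rw [Ideal.map_span, ← Set.range_comp]
    exact h
  rw [IsLocalization.mem_map_algebraMap_iff ((nonZeroDivisors A).map (C : A →+* MvPolynomial ι A))]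
    at h'
  obtain ⟨⟨⟨x, hx⟩, ⟨s, c, hc, hs⟩⟩, hxs⟩ := h'
  refine ⟨c, nonZeroDivisors.ne_zero hc, ?_⟩
  simp only [← map_mul] at hxs
  have := map_injective _ (IsFractionRing.injective A K) hxs
  rw [← hs] at this
  rw [mul_comm]
  change g * C c = x at this
  rwa [this]

variable {k : Type*} [Field k] {σ τ : Type}

/-- Base change of `k[x, y]` to `k(y)[x]`. -/
noncomputable def toFracX (k : Type*) [Field k] (σ τ : Type) :
    MvPolynomial (σ ⊕ τ) k →ₐ[k] MvPolynomial σ (FractionRing (MvPolynomial τ k)) :=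
  aeval (Sum.elim X fun j => C (algebraMap (MvPolynomial τ k) _ (X j)))

theorem toFracX_eq (p : MvPolynomial (σ ⊕ τ) k) :
    toFracX k σ τ p = map (algebraMap (MvPolynomial τ k) (FractionRing (MvPolynomial τ k)))
      (sumAlgEquiv k σ τ p) := by
  have : (toFracX k σ τ : _ →+* _) = (map (algebraMap (MvPolynomial τ k)
      (FractionRing (MvPolynomial τ k)))).comp (sumAlgEquiv k σ τ).toRingEquiv.toRingHom := by
    refine ringHom_ext (fun c => ?_) ?_
    · simp [toFracX]
      rfl
    · rintro (i | j) <;> simp [toFracX]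
  exact RingHom.congr_fun this p

theorem toFracX_rename_inr (p : MvPolynomial τ k) :
    toFracX k σ τ (rename Sum.inr p) = C (algebraMap (MvPolynomial τ k) _ p) := by
  have h := DFunLike.congr_fun (sumAlgEquiv_comp_rename_inr k σ τ) p
  rw [toFracX_eq]
  have h' : sumAlgEquiv k σ τ (rename Sum.inr p) = C p := h
  rw [h', map_C]

theorem exists_rename_mul_mem_span {β : Type*} {f : β → MvPolynomial (σ ⊕ τ) k}
    {g : MvPolynomial (σ ⊕ τ) k}
    (h : toFracX k σ τ g ∈ Ideal.span (Set.range fun i => toFracX k σ τ (f i))) :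
    ∃ c : MvPolynomial τ k, c ≠ 0 ∧ rename Sum.inr c * g ∈ Ideal.span (Set.range f) := by
  simp only [toFracX_eq] at h
  obtain ⟨c, hc, hcg⟩ := exists_C_mul_mem_span h
  refine ⟨c, hc, ?_⟩
  have h2 := Ideal.mem_map_of_mem (sumAlgEquiv k σ τ).symm hcg
  rw [Ideal.map_span, ← Set.range_comp, map_mul] at h2
  have h3 : (sumAlgEquiv k σ τ).symm (C c) = rename Sum.inr c := by
    rw [AlgEquiv.symm_apply_eq]
    exact (DFunLike.congr_fun (sumAlgEquiv_comp_rename_inr k σ τ) c).symm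
  simpa [Function.comp_def, h3] using h2

end Localization

/-! ### An equation for the generic linear form modulo the deformed system -/

section Limit

variable {σ τ : Type} [Fintype σ] [DecidableEq σ] [Fintype τ] {k : Type*} [Field k]

/-- The substitution `T ↦ ∑ s_i x_i`, `s_i ↦ s_i`, `y_j ↦ y_j`. -/
noncomputable def evalForm {R : Type*} [CommRing R] (τ : Type) (s : σ → R) :
    MvPolynomial (Option (σ ⊕ τ)) R →ₐ[R] MvPolynomial (σ ⊕ τ) R :=
  aeval fun o => o.elim (∑ i, C (s i) * X (Sum.inl i)) (Sum.elim (fun i => C (s i)) (X ∘ Sum.inr))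

/-- A relation of degree at most `d ^ #σ` in `T` and the `y_j` for the generic linear form
`T = ∑ s_i x_i` modulo the deformed system. -/
theorem exists_form_relation {d : ℕ} (hd : 0 < d)
    {F : σ → MvPolynomial (σ ⊕ τ) k} (hF : ∀ i, (F i).totalDegree ≤ d) :
    ∃ D : MvPolynomial (Option (σ ⊕ τ)) (RatFunc k), D ≠ 0 ∧
      D ∈ wDeg (RatFunc k) (fun o => o.elim 1 (Sum.elim (fun _ : σ => 0) fun _ : τ => 1)) 0
        (d ^ Fintype.card σ) ∧
      ∀ s : σ → RatFunc k, evalForm τ s D ∈ Ideal.span (Set.range (deform d F)) := by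
  classical
  choose M hM hMG using fun i : σ => exists_mulMatrix hd hF (p := X (Sum.inl i)) (e := 1)
    (by simp)
  let w : Option (σ ⊕ τ) → ℕ := fun o => o.elim 1 (Sum.elim (fun _ : σ => 0) fun _ : τ => 1)
  -- Working modulo the deformed system means setting its members to `0` in the multiplication
  -- matrices. The freed variables `Sum.inl i` are reused for the coefficients `s_i`, with weight
  -- `0`.
  let z : σ ⊕ τ → MvPolynomial (σ ⊕ τ) (RatFunc k) := Sum.elim 0 (X ∘ Sum.inr)
  -- The matrix of multiplication by `∑ s_i x_i` modulo the deformed system.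
  let B : Matrix (σ → Fin d) (σ → Fin d) (MvPolynomial (σ ⊕ τ) (RatFunc k)) :=
    ∑ i, (X (Sum.inl i) : MvPolynomial (σ ⊕ τ) (RatFunc k)) • (M i).map (aeval z)
  have hBapp : ∀ α β, B α β = ∑ i, X (Sum.inl i) * aeval z (M i α β) := fun α β => by
    simp [B, Matrix.sum_apply]
  let N : Matrix (σ → Fin d) (σ → Fin d) (MvPolynomial (Option (σ ⊕ τ)) (RatFunc k)) :=
    Matrix.diagonal (fun _ => X none) - B.map (rename some)
  have hN : ∀ α β, N α β ∈ wDeg (RatFunc k) w (∑ i, (β i : ℕ)) (1 + ∑ i, (α i : ℕ)) := by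
    intro α β
    refine sub_mem ?_ ?_
    · rcases eq_or_ne α β with rfl | h
      · rw [Matrix.diagonal_apply_eq]
        exact wDeg_mono (by simp [w, add_comm]) (X_mem_wDeg (w := w) none)
      · rw [Matrix.diagonal_apply_ne _ h]
        exact zero_mem _
    · rw [Matrix.map_apply]
      refine rename_mem_wDeg (w := Sum.elim (fun _ : σ => 0) fun _ : τ => 1) some (fun _ => rfl) ?_
      rw [hBapp]
      refine Submodule.sum_mem _ fun i _ => ?_
      refine wDeg_mono ?_ (mul_mem_wDeg (X_mem_wDeg (Sum.inl i)) (aeval_mem_wDeg ?_ (hM i α β)))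
      · simp
      · rintro (i | j)
        · exact zero_mem _
        · exact X_mem_wDeg (w := Sum.elim (fun _ : σ => 0) fun _ : τ => 1) (Sum.inr j)
  refine ⟨N.det, ?_, by simpa using det_mem_wDeg hN, fun s => ?_⟩
  · intro h0
    have h1 : optionEquivLeft (RatFunc k) (σ ⊕ τ) N.det = B.charpoly := by
      have hθ : ∀ p : MvPolynomial (σ ⊕ τ) (RatFunc k),
          optionEquivLeft (RatFunc k) (σ ⊕ τ) (rename some p) = Polynomial.C p := by
        intro p
        have : ((optionEquivLeft (RatFunc k) (σ ⊕ τ)).toAlgHom.comp (rename some)) =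
            Polynomial.CAlgHom.comp
              (AlgHom.id (RatFunc k) (MvPolynomial (σ ⊕ τ) (RatFunc k))) := by
          ext i
          simp
        exact DFunLike.congr_fun this p
      rw [AlgEquiv.map_det, Matrix.charpoly]
      congr 1
      ext1 α β
      by_cases h : α = β
      · subst h
        simp [N, hθ, Matrix.charmatrix_apply_eq]
      · simp [N, hθ, h]
    rw [h0, map_zero] at h1
    exact B.charpoly_monic.ne_zero h1.symm
  · rw [← Ideal.Quotient.eq_zero_iff_mem]
    set J := Ideal.span (Set.range (deform d F)) with hJ
    let q := Ideal.Quotient.mkₐ (RatFunc k) J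
    change q (evalForm τ s N.det) = 0
    rw [AlgHom.map_det, AlgHom.map_det]
    have hz : ∀ p : MvPolynomial (σ ⊕ τ) (RatFunc k), q (aeval (Sum.elim (deform d F) (X ∘ Sum.inr)) p) =
        q (aeval z p) := by
      intro p
      have : q.comp (aeval (Sum.elim (deform d F) (X ∘ Sum.inr))) = q.comp (aeval z) := by
        ext i
        rcases i with i | j
        · simp only [AlgHom.comp_apply, aeval_X, Sum.elim_inl, z, Pi.zero_apply, map_zero]
          exact Ideal.Quotient.eq_zero_iff_mem.2 (Ideal.subset_span ⟨i, rfl⟩)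
        · simp [z]
      exact DFunLike.congr_fun this p
    refine det_eq_zero_of_sum_eq (v := fun α => q (∏ i, X (Sum.inl i) ^ (α i : ℕ)))
      (a := fun _ => ⟨0, hd⟩) (by simp) ?_
    ext1 α
    have h1 : ∀ p : MvPolynomial (σ ⊕ τ) (RatFunc k), q (evalForm τ s (rename some (aeval z p))) =
        q (aeval z p) := fun p => by
      congr 1
      have : ((evalForm τ s).comp (rename some)).comp (aeval z) = aeval z := by
        ext1 i
        rcases i with i | j <;> simp [z, evalForm]
      exact DFunLike.congr_fun this p
    have h2 : ∀ i, evalForm τ s (rename some (X (Sum.inl i))) = C (s i) := fun i => by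
      simp [evalForm]
    have h3 : evalForm τ s (X none) = ∑ i, C (s i) * X (Sum.inl i) := by simp [evalForm]
    have h4 : ∀ i, q (C (s i)) * (q (X (Sum.inl i)) * q (∏ i, X (Sum.inl i) ^ (α i : ℕ))) =
        ∑ β, q (C (s i)) * (q (aeval z (M i α β)) * q (∏ i, X (Sum.inl i) ^ (β i : ℕ))) := by
      intro i
      have := congrArg q (hMG i α)
      rw [map_X, map_mul, map_sum] at this
      rw [this, Finset.mul_sum]
      simp only [map_mul, hz]
    simp only [Matrix.mulVec, dotProduct, AlgHom.mapMatrix_apply, Matrix.map_apply,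
      Matrix.sub_apply, map_sub, N, sub_mul, Finset.sum_sub_distrib, Pi.zero_apply, hBapp,
      map_sum, map_mul, h1, h2, Finset.sum_mul]
    rw [Finset.sum_eq_single α]
    · rw [Matrix.diagonal_apply_eq, h3, map_sum, Finset.sum_mul, sub_eq_zero, Finset.sum_comm]
      refine Finset.sum_congr rfl fun i _ => ?_
      rw [map_mul, mul_assoc]
      simpa only [mul_assoc] using h4 i
    · intro β _ h
      rw [Matrix.diagonal_apply_ne _ h.symm, map_zero, map_zero, zero_mul]
    · simp

end Limit

/-! ### The equation at an isolated zero -/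

section Isolated

variable {σ τ : Type} [Fintype σ] [DecidableEq σ] [Fintype τ] {k : Type*} [Field k]

/-- The relation of `exists_form_relation`, specialized to `δ = 0`: it vanishes at every isolated
zero of the system `F` over `k(y)`. -/
theorem exists_form_relation_at_isolated {d : ℕ} (hd : 0 < d)
    {F : σ → MvPolynomial (σ ⊕ τ) k} (hF : ∀ i, (F i).totalDegree ≤ d) :
    ∃ D : MvPolynomial (Option (σ ⊕ τ)) k, D ≠ 0 ∧
      D ∈ wDeg k (fun o => o.elim 1 (Sum.elim (fun _ : σ => 0) fun _ : τ => 1)) 0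
        (d ^ Fintype.card σ) ∧
      ∀ m : Ideal (MvPolynomial σ (FractionRing (MvPolynomial τ k))), m.IsMaximal →
        m ∈ (Ideal.span (Set.range fun i => toFracX k σ τ (F i))).minimalPrimes →
        ∀ s : σ → k, toFracX k σ τ (evalForm τ s D) ∈ m := by
  obtain ⟨D, hD0, hD, hDJ⟩ := exists_form_relation hd hF
  obtain ⟨c, hc, ψ, hψ, hψ0⟩ := exists_C_mul_eq_map_of_ne_zero hD0
  have hinj := IsFractionRing.injective (Polynomial k) (RatFunc k)
  refine ⟨_, hψ0, map_mem_wDeg _ (wDeg_of_C_mul_eq_map hinj hD hψ), fun m hm hmin s => ?_⟩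
  let R := MvPolynomial σ (FractionRing (MvPolynomial τ k))
  let s' : σ → Polynomial k := fun i => Polynomial.C (s i)
  have h1 : map (algebraMap (Polynomial k) (RatFunc k)) (evalForm τ s' ψ) ∈
      Ideal.span (Set.range fun i =>
        map (algebraMap (Polynomial k) (RatFunc k)) (deformPoly d F i)) := by
    simp only [map_deformPoly]
    have h2 := Ideal.mul_mem_left _ (C c)
      (hDJ fun i => algebraMap (Polynomial k) (RatFunc k) (s' i))
    have h3 : map (algebraMap (Polynomial k) (RatFunc k)) (evalForm τ s' ψ) =
        C c * evalForm τ (fun i => algebraMap (Polynomial k) (RatFunc k) (s' i)) D := by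
      rw [evalForm, map_aeval_eq, ← hψ, map_mul]
      have : (fun i : Option (σ ⊕ τ) => map (algebraMap (Polynomial k) (RatFunc k))
          (i.elim (∑ i, C (s' i) * X (Sum.inl i))
            (Sum.elim (fun i => C (s' i)) (X ∘ Sum.inr)))) =
          fun o => o.elim (∑ i, C (algebraMap (Polynomial k) (RatFunc k) (s' i)) * X (Sum.inl i))
            (Sum.elim (fun i => C (algebraMap (Polynomial k) (RatFunc k) (s' i)))
              (X ∘ Sum.inr)) := by
        funext o
        rcases o with _ | i | j <;> simp
      rw [this, aeval_C, algebraMap_eq]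
      rfl
    rwa [h3]
  -- Membership over `k(δ)` becomes membership over `k[δ]` after multiplication by some `e(δ)`.
  -- Splitting off the power of `δ` in `e` leaves a factor nonzero at `δ = 0`, as
  -- `eval_zero_mem_of_isolated` requires.
  obtain ⟨e, he, heJ⟩ := exists_C_mul_mem_span h1
  let ρ : MvPolynomial (σ ⊕ τ) (Polynomial k) →+* Polynomial R :=
    eval₂Hom (Polynomial.mapRingHom (algebraMap k R))
      fun v => Polynomial.C (toFracX k σ τ (X v))
  have hρC : ∀ p : MvPolynomial (σ ⊕ τ) k, ρ (map Polynomial.C p) =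
      Polynomial.C (toFracX k σ τ p) := by
    intro p
    have : ρ.comp (map Polynomial.C) = Polynomial.C.comp (toFracX k σ τ).toRingHom := by
      refine ringHom_ext (fun c => ?_) fun v => by simp [ρ]
      simp [ρ]
      rfl
    exact RingHom.congr_fun this p
  have h4 := Ideal.mem_map_of_mem ρ heJ
  rw [Ideal.map_span, ← Set.range_comp, map_mul] at h4
  have h5 : (ρ ∘ deformPoly d F) = fun i => Polynomial.C (toFracX k σ τ (F i)) +
      Polynomial.X * Polynomial.C ((X i : R) ^ d) := by
    funext i
    rw [Function.comp_apply, deformPoly, map_add, hρC]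
    simp [ρ, toFracX]
  obtain ⟨e', he', hndvd⟩ := Polynomial.exists_eq_pow_rootMultiplicity_mul_and_not_dvd e he 0
  rw [Polynomial.C_0, sub_zero] at he' hndvd
  have h6 : ρ (C e) = Polynomial.X ^ (e.rootMultiplicity 0) * e'.map (algebraMap k R) := by
    conv_lhs => rw [he']
    simp [ρ]
  rw [h5, h6] at h4
  have h7 : (e'.map (algebraMap k R)).eval 0 ∉ m := by
    rw [← Polynomial.coeff_zero_eq_eval_zero, Polynomial.coeff_map]
    intro h
    rw [Polynomial.X_dvd_iff] at hndvd
    exact hm.ne_top (m.eq_top_of_isUnit_mem h ((IsUnit.mk0 _ hndvd).map (algebraMap k R)))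
  have h8 := eval_zero_mem_of_isolated (m := m) (by
    rw [height_eq_card_of_isMaximal, Nat.card_eq_fintype_card]) hmin (fun i => X i ^ d) h7 h4
  have h9 : ∀ p, (ρ p).eval 0 = toFracX k σ τ (map (Polynomial.evalRingHom 0) p) := by
    intro p
    have : (Polynomial.evalRingHom 0).comp ρ =
        (toFracX k σ τ).toRingHom.comp (map (Polynomial.evalRingHom 0)) := by
      refine ringHom_ext (fun c => ?_) fun v => by simp [ρ]
      simp only [RingHom.comp_apply, ρ, coe_eval₂Hom, eval₂_C, map_C, Polynomial.coe_mapRingHom,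
        Polynomial.coe_evalRingHom]
      rw [← Polynomial.coeff_zero_eq_eval_zero, Polynomial.coeff_map,
        Polynomial.coeff_zero_eq_eval_zero]
      exact ((toFracX k σ τ).commutes _).symm
    exact RingHom.congr_fun this p
  rw [h9] at h8
  convert h8 using 2
  rw [evalForm, evalForm, map_aeval_eq]
  congr 2
  funext o
  rcases o with _ | i | j <;> simp [s']

end Isolated

/-! ### Specializing an integral zero -/

section Integrality

variable {σ τ : Type} {k : Type*} [Field k]

/-- The specialization `y = a`. -/
noncomputable def specializeAt (σ : Type) (a : τ → k) :
    MvPolynomial (σ ⊕ τ) k →ₐ[k] MvPolynomial σ k :=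
  aeval (Sum.elim X fun j => C (a j))

/-- If a zero of `f` over an extension of `k(y)` has coordinates integral over the local ring of
`y = a`, then the specialized system has no Nullstellensatz certificate. -/
theorem one_notMem_span_specializeAt {β L : Type*} [Field L] {f : β → MvPolynomial (σ ⊕ τ) k}
    (a : τ → k) (φ : MvPolynomial (σ ⊕ τ) k →+* L) (hφ : ∀ i, φ (f i) = 0)
    {D : Type*} [CommRing D] [IsLocalRing D] (η : MvPolynomial τ k →+* D) (χ : D →+* L)
    (hχ : ∀ p, χ (η p) = φ (rename Sum.inr p))
    (hη : ∀ j, η (X j - C (a j)) ∈ IsLocalRing.maximalIdeal D)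
    (hint : ∀ i, χ.IsIntegralElem (φ (X (Sum.inl i)))) :
    (1 : MvPolynomial σ k) ∉ Ideal.span (Set.range fun i => specializeAt σ a (f i)) := by
  let _ : Algebra D L := χ.toAlgebra
  let S := integralClosure D L
  have hker : RingHom.ker (algebraMap D S) ≤ IsLocalRing.maximalIdeal D :=
    IsLocalRing.le_maximalIdeal (RingHom.ker_ne_top _)
  -- A maximal ideal of the integral closure over that of `D`. The coordinates of the zero lie in
  -- `S`, and modulo `Q` they form a zero of the system specialized at `a`.
  obtain ⟨Q, hQ, hQD⟩ := Ideal.exists_ideal_over_maximal_of_isIntegral (S := S)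
    (IsLocalRing.maximalIdeal D) hker
  let ξ : σ → S := fun i => ⟨φ (X (Sum.inl i)), hint i⟩
  let ω : MvPolynomial (σ ⊕ τ) k →+* S := eval₂Hom ((algebraMap D S).comp (η.comp C))
    (Sum.elim ξ fun j => algebraMap D S (η (X j)))
  have hω : ∀ p, (ω p : L) = φ p := by
    intro p
    have : S.val.toRingHom.comp ω = φ := by
      refine ringHom_ext (fun c => ?_) ?_
      · have := hχ (C c)
        rw [rename_C] at this
        rw [← this]
        simp [ω]
        rfl
      · rintro (i | j)
        · simp [ω, ξ]
        · have := hχ (X j)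
          rw [rename_X] at this
          rw [← this]
          simp [ω]
          rfl
    exact RingHom.congr_fun this p
  have hωf : ∀ i, ω (f i) = 0 := fun i => Subtype.ext (by rw [hω, hφ]; rfl)
  let π := Ideal.Quotient.mk Q
  let θ : MvPolynomial σ k →+* S ⧸ Q := eval₂Hom (π.comp ((algebraMap D S).comp (η.comp C)))
    fun i => π (ξ i)
  have hθ : ∀ p, θ (specializeAt σ a p) = π (ω p) := by
    intro p
    have : θ.comp (specializeAt σ a).toRingHom = π.comp ω := by
      refine ringHom_ext (fun c => by simp [θ, ω]) ?_
      rintro (i | j)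
      · simp [θ, ω, specializeAt]
      · have h1 : algebraMap D S (η (X j - C (a j))) ∈ Q := by
          have := hη j
          rwa [← hQD, Ideal.mem_comap] at this
        have h2 : π (algebraMap D S (η (X j - C (a j)))) = 0 := Ideal.Quotient.eq_zero_iff_mem.2 h1
        rw [map_sub, map_sub, map_sub, sub_eq_zero] at h2
        simp [θ, ω, specializeAt, h2]
    exact RingHom.congr_fun this p
  intro h
  have hle : Ideal.span (Set.range fun i => specializeAt σ a (f i)) ≤ RingHom.ker θ := by
    rw [Ideal.span_le]
    rintro _ ⟨i, rfl⟩
    rw [SetLike.mem_coe, RingHom.mem_ker, hθ, hωf, map_zero]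
  have h1 := hle h
  rw [RingHom.mem_ker, map_one] at h1
  have : Nontrivial (S ⧸ Q) := Ideal.Quotient.nontrivial_iff.2 hQ.ne_top
  exact one_ne_zero h1

end Integrality

/-! ### Degrees of iterated coefficients -/

section IteratedDegree

variable {σ τ R : Type*} [CommRing R]

theorem sumAlgEquiv_monomial (m : σ ⊕ τ →₀ ℕ) (r : R) :
    sumAlgEquiv R σ τ (monomial m r) =
      monomial (Finsupp.sumFinsuppAddEquivProdFinsupp m).1
        (monomial (Finsupp.sumFinsuppAddEquivProdFinsupp m).2 r) := by
  change AddMonoidAlgebra.curryAlgEquiv R (AddMonoidAlgebra.domCongr R R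
    Finsupp.sumFinsuppAddEquivProdFinsupp (AddMonoidAlgebra.single m r)) = _
  rw [AddMonoidAlgebra.domCongr_single]
  exact AddMonoidAlgebra.curryAlgEquiv_single _ _ r

theorem totalDegree_coeff_sumAlgEquiv_le [Fintype σ] [Fintype τ] {b : ℕ}
    {c : MvPolynomial (σ ⊕ τ) R}
    (hc : c ∈ wDeg R (Sum.elim (fun _ : σ => 0) fun _ : τ => 1) 0 b) (μ : σ →₀ ℕ) :
    (coeff μ (sumAlgEquiv R σ τ c)).totalDegree ≤ b := by
  classical
  rw [← mem_wDeg_one_iff, c.as_sum, map_sum, coeff_sum]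
  refine Submodule.sum_mem _ fun m hm => ?_
  rw [sumAlgEquiv_monomial, coeff_monomial]
  split_ifs
  · refine monomial_mem_wDeg _ ?_
    have := hc hm
    simp only [Set.mem_ofPred_eq, Finsupp.weight_apply] at this ⊢
    rw [Finsupp.sum_fintype _ _ (by simp), Fintype.sum_sum_type] at this
    rw [Finsupp.sum_fintype _ _ (by simp)]
    simpa using this
  · exact zero_mem _

theorem coeff_optionEquivLeft_mem_wDeg [Fintype σ] {w : σ → ℕ} {e b : ℕ}
    {p : MvPolynomial (Option σ) R} (hp : p ∈ wDeg R (fun o => o.elim e w) 0 b) (n : ℕ) :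
    (optionEquivLeft R σ p).coeff n ∈ wDeg R w (e * n) b := by
  intro m hm
  have := hp ((mem_support_coeff_optionEquivLeft R).1 hm)
  simp only [Set.mem_ofPred_eq, Finsupp.weight_apply] at this ⊢
  rw [Finsupp.sum_fintype _ _ (by simp), Fintype.sum_option] at this
  rw [Finsupp.sum_fintype _ _ (by simp), mul_comm e n]
  simp only [Finsupp.optionElim_apply_none, Finsupp.optionElim_apply_some, Option.elim_none,
    Option.elim_some, smul_eq_mul] at this ⊢
  omega

end IteratedDegree

/-! ### Zero-dimensional ideals over `k(y)` and generic square subsystems -/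

section ZeroDimensional

variable {σ τ : Type} {k : Type*} [Field k]

/-- The quotient is a domain generated over `K` by algebraic elements, hence a field. -/
theorem isMaximal_of_forall_exists_aeval_mem {K : Type*} [Field K] (Q : Ideal (MvPolynomial σ K))
    [Q.IsPrime] (h : ∀ i, ∃ p : Polynomial K, p ≠ 0 ∧ Polynomial.aeval (X i) p ∈ Q) :
    Q.IsMaximal := by
  have hint : ∀ i, IsIntegral K (Ideal.Quotient.mkₐ K Q (X i)) := fun i => by
    obtain ⟨p, hp, hpQ⟩ := h i
    refine IsAlgebraic.isIntegral ⟨p, hp, ?_⟩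
    rw [Polynomial.aeval_algHom_apply]
    exact Ideal.Quotient.eq_zero_iff_mem.2 hpQ
  have hall : ∀ p, IsIntegral K (Ideal.Quotient.mkₐ K Q p) := by
    intro p
    induction p using MvPolynomial.induction_on with
    | C a => exact ((Ideal.Quotient.mkₐ K Q).commutes a) ▸ isIntegral_algebraMap
    | add p q hp hq => exact (map_add (Ideal.Quotient.mkₐ K Q) p q) ▸ hp.add hq
    | mul_X p i hp => exact (map_mul (Ideal.Quotient.mkₐ K Q) p (X i)) ▸ hp.mul (hint i)
  have : Algebra.IsIntegral K (MvPolynomial σ K ⧸ Q) := ⟨fun x => by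
    obtain ⟨p, rfl⟩ := Ideal.Quotient.mk_surjective x
    exact hall p⟩
  exact Ideal.Quotient.maximal_of_isField _
    (isField_of_isIntegral_of_isField' (R := K) (Field.toIsField K))

/-- Inclusion of `k[x_i, y]` into `k[x, y]`. -/
def optionInl (τ : Type) (i : σ) : Option τ → σ ⊕ τ := fun o => o.elim (Sum.inl i) Sum.inr

theorem toFracX_rename_optionInl (i : σ) (p : MvPolynomial (Option τ) k) :
    toFracX k σ τ (rename (optionInl τ i) p) = Polynomial.aeval (X i)
      ((optionEquivLeft k τ p).map
        (algebraMap (MvPolynomial τ k) (FractionRing (MvPolynomial τ k)))) := by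
  have : (toFracX k σ τ).toRingHom.comp (rename (optionInl τ i)).toRingHom =
      ((Polynomial.aeval (X i : MvPolynomial σ (FractionRing (MvPolynomial τ k)))).toRingHom.comp
        (Polynomial.mapRingHom
          (algebraMap (MvPolynomial τ k) (FractionRing (MvPolynomial τ k))))).comp
        (optionEquivLeft k τ).toRingEquiv.toRingHom := by
    refine ringHom_ext (fun c => ?_) ?_
    · simp [toFracX]
      rfl
    · rintro (_ | j) <;> simp [toFracX, optionInl]
  exact RingHom.congr_fun this p

/-- A prime `m` of height at most `#σ` that is isolated among the zeros of the `f i` is minimal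
over `#σ` generic `k`-combinations of the `f i`. -/
theorem exists_system_minimalPrimes {σ β V R : Type*} [Fintype σ] [Infinite k] [AddCommGroup V]
    [Module k V] [CommRing R] [IsNoetherianRing R] [Algebra k R] (θ : V →ₗ[k] R) {f : β → V}
    (m : Ideal R) [m.IsPrime] (hh : m.height ≤ Fintype.card σ)
    (hm : ∀ Q : Ideal R, Q.IsPrime → (∀ i, θ (f i) ∈ Q) → Q ≤ m → Q = m)
    (hfm : ∀ i, θ (f i) ∈ m) :
    ∃ F : σ → V, (∀ i, F i ∈ Submodule.span k (Set.range f)) ∧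
      m ∈ (Ideal.span (Set.range fun i => θ (F i))).minimalPrimes := by
  let W : Submodule k R := (Submodule.span k (Set.range f)).map θ
  obtain ⟨G, hGW, hG⟩ := exists_seq_mem_forall_minimalPrimes W (Fintype.card σ)
  choose F hF hFG using fun i => Submodule.mem_map.1 (hGW i)
  refine ⟨fun i => F (Fintype.equivFin σ i), fun i => hF _, ?_⟩
  have hrange : Set.range (fun i => θ (F (Fintype.equivFin σ i))) = Set.range G := by
    rw [← (Fintype.equivFin σ).surjective.range_comp G]
    exact congrArg Set.range (funext fun i => hFG _)
  rw [hrange]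
  have hWm : W ≤ m.restrictScalars k := by
    rw [Submodule.map_span_le]
    rintro _ ⟨i, rfl⟩
    exact hfm i
  have hGm : Ideal.span (Set.range G) ≤ m := by
    rw [Ideal.span_le]
    rintro _ ⟨i, rfl⟩
    exact hWm (hGW i)
  obtain ⟨Q, hQ, hQm⟩ := Ideal.exists_minimalPrimes_le hGm
  have hQp : Q.IsPrime := hQ.1.1
  have : Q = m := by
    -- Either `Q` contains all `θ (f i)` and isolation applies, or `Q` already has height `#σ` and
    -- cannot lie strictly inside `m`.
    rcases hG Q hQ with h | h
    · refine hm Q hQp (fun i => h ?_) hQm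
      exact Submodule.mem_map_of_mem (Submodule.subset_span ⟨i, rfl⟩)
    · by_contra hne
      have h1 := ((add_le_add_left h 1).trans
        (Ideal.height_add_one_le_of_lt_of_isPrime (lt_of_le_of_ne hQm hne))).trans hh
      norm_cast at h1
      omega
  rwa [← this]

theorem exists_eval_ne_zero_of_linearForm_ne_zero [Infinite k] [Finite σ] {c : MvPolynomial σ k}
    (hc : c ≠ 0) {ℓ : (σ → k) →ₗ[k] k} (hℓ : ℓ ≠ 0) : ∃ s, eval s c ≠ 0 ∧ ℓ s ≠ 0 := by
  classical
  cases nonempty_fintype σ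
  let q : MvPolynomial σ k := ∑ i, C (ℓ (Pi.single i 1)) * X i
  have hq : ∀ s, eval s q = ℓ s := fun s => by
    conv_rhs => rw [LinearMap.pi_apply_eq_sum_univ ℓ s]
    simp [q, mul_comm]
    refine Finset.sum_congr rfl fun i _ => ?_
    congr 2
    ext j
    simp [Pi.single_apply, eq_comm]
  have hq0 : q ≠ 0 := by
    rintro h
    apply hℓ
    ext1 i
    ext1
    simp [← hq, h]
  by_contra! hcon
  apply mul_ne_zero hc hq0
  apply MvPolynomial.funext
  intro s
  rw [map_mul, map_zero, hq]
  by_cases h : eval s c = 0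
  · rw [h, zero_mul]
  · rw [hcon s h, mul_zero]

end ZeroDimensional

/-! ### Solvability at generic parameters: the zero-dimensional case -/

section Dominant

variable {σ τ : Type} {k : Type*} [Field k]

theorem totalDegree_le_of_mem_span {β ι : Type*} {f : β → MvPolynomial ι k} {d : ℕ}
    (hf : ∀ i, (f i).totalDegree ≤ d) {p : MvPolynomial ι k}
    (hp : p ∈ Submodule.span k (Set.range f)) : p.totalDegree ≤ d := by
  rw [← mem_wDeg_one_iff]
  have : Submodule.span k (Set.range f) ≤ wDeg k (fun _ => 1) 0 d := by
    rw [Submodule.span_le]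
    rintro _ ⟨i, rfl⟩
    exact mem_wDeg_one_iff.2 (hf i)
  exact this hp

theorem evalForm_eq {R : Type*} [CommRing R] [Fintype σ] (s : σ → R)
    (D : MvPolynomial (Option (σ ⊕ τ)) R) :
    evalForm τ s D = (optionEquivLeft R (σ ⊕ τ) D).eval₂
      (aeval (Sum.elim (fun i => C (s i)) (X ∘ Sum.inr))).toRingHom
      (∑ i, C (s i) * X (Sum.inl i)) := by
  have : (evalForm τ s).toRingHom = (Polynomial.eval₂RingHom
      (aeval (Sum.elim (fun i => C (s i)) (X ∘ Sum.inr)) :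
        MvPolynomial (σ ⊕ τ) R →ₐ[R] MvPolynomial (σ ⊕ τ) R).toRingHom
      (∑ i, C (s i) * X (Sum.inl i))).comp (optionEquivLeft R (σ ⊕ τ)).toRingEquiv.toRingHom := by
    refine ringHom_ext (fun c => by simp [evalForm]) ?_
    rintro (_ | i | j) <;> simp [evalForm]
  exact RingHom.congr_fun this D

theorem isIntegralElem_of_isUnit_leadingCoeff {A B : Type*} [CommRing A] [CommRing B]
    [Nontrivial A] (χ : A →+* B) {p : Polynomial A} (hp : IsUnit p.leadingCoeff) {x : B}
    (h : p.eval₂ χ x = 0) : χ.IsIntegralElem x := by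
  obtain ⟨u, hu⟩ := hp
  refine ⟨Polynomial.C ((u⁻¹ : Aˣ) : A) * p, ?_, by rw [Polynomial.eval₂_mul, h, mul_zero]⟩
  rw [Polynomial.Monic, Polynomial.leadingCoeff_mul', Polynomial.leadingCoeff_C, ← hu,
    Units.inv_mul]
  rw [Polynomial.leadingCoeff_C, ← hu, Units.inv_mul]
  exact one_ne_zero

/-- If a zero of `f` over an extension of `k(y)` satisfies a relation for the generic linear form,
then the specialized system at `a` is solvable whenever a leading coefficient does not vanish. -/
theorem one_notMem_span_of_form_relation [Infinite k] [Fintype σ] [DecidableEq σ] {β L : Type*}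
    [Field L] {f : β → MvPolynomial (σ ⊕ τ) k}
    (φ : MvPolynomial (σ ⊕ τ) k →+* L) (hφ : ∀ i, φ (f i) = 0)
    (hφy : ∀ p : MvPolynomial τ k, p ≠ 0 → φ (rename Sum.inr p) ≠ 0)
    {D : MvPolynomial (Option (σ ⊕ τ)) k} (hD : ∀ s : σ → k, φ (evalForm τ s D) = 0)
    (a : τ → k)
    (ha : map (eval a) (sumAlgEquiv k σ τ (optionEquivLeft k (σ ⊕ τ) D).leadingCoeff) ≠ 0) :
    (1 : MvPolynomial σ k) ∉ Ideal.span (Set.range fun i => specializeAt σ a (f i)) := by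
  let P : Ideal (MvPolynomial τ k) := RingHom.ker (eval a)
  have hP : P.IsPrime := RingHom.ker_isPrime _
  let A := Localization.AtPrime P
  let η : MvPolynomial τ k →+* A := algebraMap _ _
  let χ : A →+* L := IsLocalization.lift (M := P.primeCompl)
    (g := φ.comp (rename Sum.inr).toRingHom) fun u => IsUnit.mk0 _ (hφy _ fun h =>
      u.2 (by rw [h]; exact P.zero_mem))
  have hχ : ∀ p, χ (η p) = φ (rename Sum.inr p) := fun p => IsLocalization.lift_eq _ p
  have hunit : ∀ p, eval a p ≠ 0 → IsUnit (η p) := fun p hp =>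
    IsLocalization.map_units A (⟨p, hp⟩ : P.primeCompl)
  set q := optionEquivLeft k (σ ⊕ τ) D with hq
  let Λ : (σ → k) → L := fun s => φ (∑ i, C (s i) * X (Sum.inl i))
  -- If the leading coefficient is nonzero at `(s, a)`, it is a unit in the local ring of `y = a`,
  -- so the equation at `s` makes the linear form integral.
  have hΛint : ∀ s, eval s (map (eval a) (sumAlgEquiv k σ τ q.leadingCoeff)) ≠ 0 →
      χ.IsIntegralElem (Λ s) := by
    intro s hs
    let γ₀ : MvPolynomial (σ ⊕ τ) k →+* MvPolynomial τ k :=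
      (aeval (Sum.elim (fun i => C (s i)) X)).toRingHom
    have h1 : eval a (γ₀ q.leadingCoeff) =
        eval s (map (eval a) (sumAlgEquiv k σ τ q.leadingCoeff)) := by
      have : (eval a).comp γ₀ = ((eval s).comp (map (eval a))).comp
          (sumAlgEquiv k σ τ).toRingEquiv.toRingHom := by
        refine ringHom_ext (fun c => by simp [γ₀]) ?_
        rintro (i | j) <;> simp [γ₀]
      exact RingHom.congr_fun this _
    have hu : IsUnit (η (γ₀ q.leadingCoeff)) := hunit _ (h1 ▸ hs)
    have hlc : (q.map (η.comp γ₀)).leadingCoeff = η (γ₀ q.leadingCoeff) :=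
      Polynomial.leadingCoeff_map_of_leadingCoeff_ne_zero _ hu.ne_zero
    refine isIntegralElem_of_isUnit_leadingCoeff χ (p := q.map (η.comp γ₀)) (hlc ▸ hu) ?_
    rw [Polynomial.eval₂_map]
    have h2 := hD s
    rw [evalForm_eq, Polynomial.hom_eval₂] at h2
    have h3 : χ.comp (η.comp γ₀) = φ.comp
        (aeval (Sum.elim (fun i => C (s i)) (X ∘ Sum.inr)) :
          MvPolynomial (σ ⊕ τ) k →ₐ[k] MvPolynomial (σ ⊕ τ) k).toRingHom := by
      refine ringHom_ext (fun c => by simp [γ₀, hχ]) ?_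
      rintro (i | j) <;> simp [γ₀, hχ]
    rwa [h3]
  have hCint : ∀ c : k, χ.IsIntegralElem (φ (C c)) := fun c => by
    have := hχ (C c)
    rw [rename_C] at this
    rw [← this]
    exact χ.isIntegralElem_map
  -- The `s` with integral linear form are a subspace containing all `s` off a hypersurface, hence
  -- everything; in particular the coordinates `x_i` themselves are integral.
  let Y : Submodule k (σ → k) :=
    { carrier := {s | χ.IsIntegralElem (Λ s)}
      zero_mem' := by
        have : Λ 0 = 0 := by simp [Λ]
        rw [Set.mem_ofPred_eq, this]
        exact χ.isIntegralElem_zero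
      add_mem' := fun {s t} hs ht => by
        have : Λ (s + t) = Λ s + Λ t := by
          simp [Λ, add_mul, Finset.sum_add_distrib]
        rw [Set.mem_ofPred_eq, this]
        exact RingHom.IsIntegralElem.add χ hs ht
      smul_mem' := fun c s hs => by
        have : Λ (c • s) = φ (C c) * Λ s := by
          simp [Λ, Finset.mul_sum, mul_assoc]
        rw [Set.mem_ofPred_eq, this]
        exact RingHom.IsIntegralElem.mul χ (hCint c) hs }
  have hY : Y = ⊤ := by
    by_contra hne
    obtain ⟨ℓ, hℓ, hYℓ⟩ := Submodule.exists_le_ker_of_lt_top Y (lt_top_iff_ne_top.2 hne)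
    obtain ⟨s, hs, hsℓ⟩ := exists_eval_ne_zero_of_linearForm_ne_zero ha hℓ
    exact hsℓ (hYℓ (hΛint s hs))
  refine one_notMem_span_specializeAt a φ hφ η χ hχ (fun j => ?_) fun i => ?_
  · refine (IsLocalization.AtPrime.to_map_mem_maximal_iff A P _ inferInstance).2 ?_
    simp [P, RingHom.mem_ker]
  · have h : Pi.single i 1 ∈ Y := hY ▸ Submodule.mem_top
    have h2 : Λ (Pi.single i 1) = φ (X (Sum.inl i)) := by
      simp [Λ, Pi.single_apply]
    exact h2 ▸ h

/-- The zero-dimensional case of `exists_totalDegree_le_one_notMem_span`. -/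
theorem exists_totalDegree_le_of_zeroDimensional [Infinite k] [Fintype σ] [DecidableEq σ]
    [Fintype τ] {β : Type*} {d : ℕ} (hd : 0 < d)
    {f : β → MvPolynomial (σ ⊕ τ) k} (hf : ∀ i, (f i).totalDegree ≤ d)
    (hI : ∀ p : MvPolynomial τ k, rename Sum.inr p ∈ Ideal.span (Set.range f) → p = 0)
    (hdim : ∀ i : σ, ∃ p : MvPolynomial (Option τ) k, p ≠ 0 ∧
      rename (optionInl τ i) p ∈ Ideal.span (Set.range f)) :
    ∃ h : MvPolynomial τ k, h ≠ 0 ∧ h.totalDegree ≤ d ^ Fintype.card σ ∧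
      ∀ a : τ → k, eval a h ≠ 0 →
        (1 : MvPolynomial σ k) ∉ Ideal.span (Set.range fun i => specializeAt σ a (f i)) := by
  have hne : Ideal.span (Set.range fun i => toFracX k σ τ (f i)) ≠ ⊤ := by
    intro h
    have h1 : toFracX k σ τ 1 ∈ Ideal.span (Set.range fun i => toFracX k σ τ (f i)) := by
      rw [h]; exact Submodule.mem_top
    obtain ⟨c, hc, hcI⟩ := exists_rename_mul_mem_span h1
    rw [mul_one] at hcI
    exact hc (hI c hcI)
  obtain ⟨m, hm, hIm⟩ := Ideal.exists_le_maximal _ hne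
  have hfm : ∀ i, toFracX k σ τ (f i) ∈ m := fun i => hIm (Ideal.subset_span ⟨i, rfl⟩)
  have hiso : ∀ Q : Ideal (MvPolynomial σ (FractionRing (MvPolynomial τ k))), Q.IsPrime →
      (∀ i, toFracX k σ τ (f i) ∈ Q) → Q ≤ m → Q = m := by
    intro Q hQ hfQ hQm
    refine (isMaximal_of_forall_exists_aeval_mem Q fun i => ?_).eq_of_le hm.ne_top hQm
    obtain ⟨p, hp, hpI⟩ := hdim i
    refine ⟨(optionEquivLeft k τ p).map (algebraMap _ _), ?_, ?_⟩
    · rw [Polynomial.map_ne_zero_iff (IsFractionRing.injective _ _)]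
      simpa using hp
    · have hle : Ideal.span (Set.range f) ≤ Q.comap (toFracX k σ τ) := by
        rw [Ideal.span_le]
        rintro _ ⟨j, rfl⟩
        exact hfQ j
      rw [← toFracX_rename_optionInl]
      exact hle hpI
  obtain ⟨F, hF, hmF⟩ := exists_system_minimalPrimes (σ := σ) (toFracX k σ τ).toLinearMap m
    (by rw [height_eq_card_of_isMaximal, Nat.card_eq_fintype_card]) hiso hfm
  obtain ⟨D, hD0, hD, hDm⟩ := exists_form_relation_at_isolated hd
    fun i => totalDegree_le_of_mem_span hf (hF i)
  have hDm' := hDm m hm hmF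
  set c := (optionEquivLeft k (σ ⊕ τ) D).leadingCoeff with hc
  have hc0 : sumAlgEquiv k σ τ c ≠ 0 := by
    simpa [hc] using hD0
  -- The leading coefficient is a polynomial in `s` over `k[y]`. Any nonzero coefficient of it
  -- serves as `h`, since its nonvanishing at `a` keeps the polynomial in `s` nonzero.
  obtain ⟨μ, hμ⟩ := exists_coeff_ne_zero hc0
  refine ⟨_, hμ, totalDegree_coeff_sumAlgEquiv_le
    (wDeg_mono (by simp) (coeff_optionEquivLeft_mem_wDeg hD _)) μ, fun a ha => ?_⟩
  let _ : Field (MvPolynomial σ (FractionRing (MvPolynomial τ k)) ⧸ m) := Ideal.Quotient.field m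
  refine one_notMem_span_of_form_relation
    ((Ideal.Quotient.mk m).comp (toFracX k σ τ).toRingHom)
    (fun i => Ideal.Quotient.eq_zero_iff_mem.2 (hfm i)) (fun p hp h => ?_)
    (fun s => Ideal.Quotient.eq_zero_iff_mem.2 (hDm' s)) a fun h => ?_
  · have h1 : toFracX k σ τ (rename Sum.inr p) ∈ m := Ideal.Quotient.eq_zero_iff_mem.1 h
    rw [toFracX_rename_inr] at h1
    refine hm.ne_top (m.eq_top_of_isUnit_mem h1 ((IsUnit.mk0 _ ?_).map C))
    rwa [Ne, FaithfulSMul.algebraMap_eq_zero_iff]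
  · apply ha
    have := congrArg (coeff μ) h
    rwa [coeff_map, coeff_zero] at this

end Dominant

/-! ### Solvability at generic parameters: the general case -/

section DominantInduction

variable {k : Type*} [Field k]

/-- Moving the variable `x_i` to the parameters. -/
def moveEquiv {σ : Type} [DecidableEq σ] (τ : Type) (i : σ) :
    σ ⊕ τ ≃ {x : σ // x ≠ i} ⊕ Option τ where
  toFun := Sum.elim (fun x => if h : x = i then Sum.inr none else Sum.inl ⟨x, h⟩)
    fun j => Sum.inr (some j)
  invFun := Sum.elim (fun x => Sum.inl x.1) fun o => o.elim (Sum.inl i) Sum.inr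
  left_inv := by
    rintro (x | j)
    · by_cases h : x = i <;> simp [h]
    · simp
  right_inv := by
    rintro (⟨x, h⟩ | _ | j)
    · simp [h]
    · simp
    · simp

/-- If `⟨f⟩` contains no nonzero polynomial in the parameters `y`, then `f` is solvable at all
parameters outside a hypersurface of degree at most `d ^ #σ`. -/
theorem exists_totalDegree_le_one_notMem_span [Infinite k] {β : Type*} {d : ℕ} (hd : 0 < d) (n : ℕ) :
    ∀ (σ τ : Type) [Fintype σ] [Fintype τ], Fintype.card σ = n →
      ∀ f : β → MvPolynomial (σ ⊕ τ) k, (∀ i, (f i).totalDegree ≤ d) →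
      (∀ p : MvPolynomial τ k, rename Sum.inr p ∈ Ideal.span (Set.range f) → p = 0) →
      ∃ h : MvPolynomial τ k, h ≠ 0 ∧ h.totalDegree ≤ d ^ n ∧
        ∀ a : τ → k, eval a h ≠ 0 →
          (1 : MvPolynomial σ k) ∉ Ideal.span (Set.range fun i => specializeAt σ a (f i)) := by
  classical
  induction n with
  | zero =>
    intro σ τ _ _ hσ f hf hI
    have := Fintype.card_eq_zero_iff.1 hσ
    exact hσ ▸ exists_totalDegree_le_of_zeroDimensional hd hf hI fun i => isEmptyElim i
  | succ n ih =>
    intro σ τ _ _ hσ f hf hI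
    by_cases hdim : ∀ i : σ, ∃ p : MvPolynomial (Option τ) k, p ≠ 0 ∧
      rename (optionInl τ i) p ∈ Ideal.span (Set.range f)
    · exact hσ ▸ exists_totalDegree_le_of_zeroDimensional hd hf hI hdim
    push Not at hdim
    obtain ⟨i₀, hi₀⟩ := hdim
    let E := moveEquiv τ i₀
    have hcard : Fintype.card {x : σ // x ≠ i₀} = n := by
      rw [Fintype.card_subtype_compl, Fintype.card_subtype_eq, hσ]
      rfl
    obtain ⟨h', h'0, h'd, h'a⟩ := ih {x : σ // x ≠ i₀} (Option τ) hcard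
      (fun i => rename E (f i)) (fun i => (totalDegree_rename_le _ _).trans (hf i)) (by
        intro p hp
        by_contra hp0
        refine hi₀ p hp0 ?_
        have h1 := Ideal.mem_map_of_mem (rename E.symm : _ →ₐ[k] MvPolynomial (σ ⊕ τ) k) hp
        rw [Ideal.map_span, ← Set.range_comp, rename_rename] at h1
        have h2 : (rename E.symm : _ →ₐ[k] MvPolynomial (σ ⊕ τ) k) ∘ (fun i => rename E (f i)) =
            f := by
          funext i
          simp [rename_rename]
        rw [h2] at h1
        exact h1)
    have hq0 : optionEquivLeft k τ h' ≠ 0 := by simpa using h'0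
    -- With `x_{i₀}` as a parameter, `h'` lies in `k[x_{i₀}, y]`. Where its leading coefficient in
    -- `x_{i₀}` is nonzero at `a`, some value `b` has `h'(b, a) ≠ 0`.
    refine ⟨(optionEquivLeft k τ h').leadingCoeff, by simpa using hq0,
      (totalDegree_coeff_optionEquivLeft_le _ _ _ _).trans
        (h'd.trans (Nat.pow_le_pow_right hd n.le_succ)), fun a ha => ?_⟩
    have hmap : (optionEquivLeft k τ h').map (eval a) ≠ 0 := by
      intro h
      apply ha
      rw [Polynomial.leadingCoeff, ← Polynomial.coeff_map, h, Polynomial.coeff_zero]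
    obtain ⟨b, hb⟩ : ∃ b, Polynomial.eval b ((optionEquivLeft k τ h').map (eval a)) ≠ 0 := by
      by_contra! hcon
      exact hmap (Polynomial.funext fun b => by rw [hcon b, Polynomial.eval_zero])
    have hab := h'a (fun o => o.elim b a) (by rwa [optionEquivLeft_elim_eval])
    intro h1
    apply hab
    -- Setting `x_{i₀} = b` carries a certificate `1 ∈ ⟨g⟩` at `a` to one at `(b, a)`.
    let ζ : MvPolynomial σ k →ₐ[k] MvPolynomial {x : σ // x ≠ i₀} k :=
      aeval fun x => if h : x = i₀ then C b else X ⟨x, h⟩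
    have h2 := Ideal.mem_map_of_mem ζ h1
    rw [Ideal.map_span, ← Set.range_comp, map_one] at h2
    have h3 : ζ ∘ (fun i => specializeAt σ a (f i)) =
        fun i => specializeAt {x : σ // x ≠ i₀} (fun o => o.elim b a) (rename E (f i)) := by
      funext i
      have : ζ.comp (specializeAt σ a) =
          (specializeAt {x : σ // x ≠ i₀} (fun o : Option τ => o.elim b a)).comp (rename E) := by
        ext1 v
        rcases v with x | j
        · by_cases hx : x = i₀ <;> simp [ζ, specializeAt, E, moveEquiv, hx]
        · simp [ζ, specializeAt, E, moveEquiv]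
      exact DFunLike.congr_fun this (f i)
    rwa [h3] at h2

end DominantInduction

/-! ### Noether normalization by linear combinations over a subfield -/

section LinearNoether

theorem homogeneousComponent_totalDegree_ne_zero {ι R : Type*} [CommRing R] {G : MvPolynomial ι R}
    (hG : G ≠ 0) : homogeneousComponent G.totalDegree G ≠ 0 := by
  obtain ⟨m, hm, hmG⟩ := Finset.exists_mem_eq_sup G.support (support_nonempty.2 hG)
    fun m => m.degree
  have h1 : m.degree = G.totalDegree := hmG.symm
  intro h
  have h2 := congrArg (coeff m) h
  rw [coeff_homogeneousComponent, if_pos h1, coeff_zero] at h2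
  exact mem_support_iff.1 hm h2

section Substitution

variable {ι K A : Type*} [Field K] [CommRing A] [Algebra K A]

/-- The substitution `T_i ↦ U_i + c_i X`. -/
noncomputable def lineSubst (U : ι → A) (c : ι → K) : MvPolynomial ι K →ₐ[K] Polynomial A :=
  aeval fun i => Polynomial.C (U i) + Polynomial.C (algebraMap K A (c i)) * Polynomial.X

theorem lineSubst_monomial (U : ι → A) (c : ι → K) (m : ι →₀ ℕ) :
    (lineSubst U c (monomial m 1)).natDegree ≤ m.degree ∧
      (lineSubst U c (monomial m 1)).coeff m.degree =
        algebraMap K A (aeval c (monomial m (1 : K))) := by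
  induction m using Finsupp.induction_linear with
  | zero => simp
  | add m m' h h' =>
    have e : (monomial (m + m') (1 : K)) = monomial m 1 * monomial m' 1 := by simp
    rw [e, map_mul, map_add]
    refine ⟨Polynomial.natDegree_mul_le_of_le h.1 h'.1, ?_⟩
    rw [Polynomial.coeff_mul_add_eq_of_natDegree_le h.1 h'.1, h.2, h'.2, map_mul, map_mul]
  | single i n =>
    have e : (monomial (Finsupp.single i n) (1 : K)) = X i ^ n := by
      rw [X_pow_eq_monomial]
    have h1 : (lineSubst U c (X i)).natDegree ≤ 1 := by
      rw [lineSubst, aeval_X]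
      compute_degree
    have h2 : (lineSubst U c (X i)).coeff 1 = algebraMap K A (c i) := by
      simp [lineSubst]
    rw [e, map_pow, Finsupp.degree_single]
    refine ⟨(Polynomial.natDegree_pow_le_of_le n h1).trans (by simp), ?_⟩
    have := Polynomial.coeff_pow_of_natDegree_le (m := n) h1
    rw [mul_one] at this
    rw [this, h2, map_pow, aeval_X, map_pow]

theorem natDegree_lineSubst_le (U : ι → A) (c : ι → K) (G : MvPolynomial ι K) :
    (lineSubst U c G).natDegree ≤ G.totalDegree := by
  conv_lhs => rw [G.as_sum, map_sum]
  refine Polynomial.natDegree_sum_le_of_forall_le _ _ fun m hm => ?_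
  have e : monomial m (coeff m G) = C (coeff m G) * monomial m 1 := by
    rw [C_mul_monomial, mul_one]
  rw [e, map_mul, ← algebraMap_eq, AlgHom.commutes, Polynomial.algebraMap_apply]
  refine (Polynomial.natDegree_C_mul_le _ _).trans ((lineSubst_monomial U c m).1.trans ?_)
  exact le_totalDegree hm

theorem coeff_lineSubst (U : ι → A) (c : ι → K) (G : MvPolynomial ι K) :
    (lineSubst U c G).coeff G.totalDegree =
      algebraMap K A (aeval c (homogeneousComponent G.totalDegree G)) := by
  rw [homogeneousComponent_apply, map_sum, map_sum, Finset.sum_filter]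
  have hsum : lineSubst U c G = ∑ m ∈ G.support, lineSubst U c (monomial m (coeff m G)) := by
    conv_lhs => rw [G.as_sum, map_sum]
  rw [hsum, Polynomial.finsetSum_coeff]
  refine Finset.sum_congr rfl fun m hm => ?_
  have e : monomial m (coeff m G) = C (coeff m G) * monomial m 1 := by
    rw [C_mul_monomial, mul_one]
  have hle : m.degree ≤ G.totalDegree := le_totalDegree hm
  rw [e, map_mul, ← algebraMap_eq, AlgHom.commutes, Polynomial.algebraMap_apply,
    Polynomial.coeff_C_mul]
  split_ifs with h
  · rw [← h, (lineSubst_monomial U c m).2, map_mul, AlgHom.commutes, map_mul]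
    rfl
  · rw [Polynomial.coeff_eq_zero_of_natDegree_lt, mul_zero]
    exact (lineSubst_monomial U c m).1.trans_lt (lt_of_le_of_ne hle h)

/-- Along the line `U + c X` the coefficient of `X ^ deg G` is the top form of `G` at `c`, a nonzero
constant of `K`. -/
theorem isIntegral_of_relation {B : Type*} [CommRing B] [Algebra K B] [Algebra A B]
    [IsScalarTower K A B] [Nontrivial A] (U : ι → A) (c : ι → K) (x : B) {G : MvPolynomial ι K}
    (hG : aeval (fun i => algebraMap A B (U i) + algebraMap K B (c i) * x) G = 0)
    (hc : aeval c (homogeneousComponent G.totalDegree G) ≠ 0) : IsIntegral A x := by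
  have hcoeff : IsUnit ((lineSubst U c G).coeff G.totalDegree) := by
    rw [coeff_lineSubst]
    exact (IsUnit.mk0 _ hc).map _
  have hdeg : (lineSubst U c G).natDegree = G.totalDegree :=
    le_antisymm (natDegree_lineSubst_le U c G)
      (Polynomial.le_natDegree_of_ne_zero hcoeff.ne_zero)
  refine isIntegralElem_of_isUnit_leadingCoeff (algebraMap A B) (p := lineSubst U c G)
    (by rwa [Polynomial.leadingCoeff, hdeg]) ?_
  have h : ((Polynomial.aeval x : Polynomial A →ₐ[A] B).restrictScalars K).comp (lineSubst U c) =
      aeval fun i => algebraMap A B (U i) + algebraMap K B (c i) * x := by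
    ext i
    simp [lineSubst, ← IsScalarTower.algebraMap_apply]
  have h2 := DFunLike.congr_fun h G
  rw [hG] at h2
  exact h2

end Substitution

/-- **Noether normalization** by linear combinations with coefficients in an infinite subfield. -/
theorem exists_linear_noether_normalization {k K B : Type*} [Field k] [Infinite k] [Field K]
    [Algebra k K] [CommRing B] [Nontrivial B] [Algebra K B] [Algebra k B] [IsScalarTower k K B]
    (n : ℕ) (v : Fin n → B) :
    ∃ (e : ℕ) (U : Fin e → B), (∀ i, U i ∈ Submodule.span k (Set.range v)) ∧
      AlgebraicIndependent K U ∧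
      ∀ j, IsIntegral (Algebra.adjoin K (Set.range U)) (v j) := by
  induction n with
  | zero =>
    refine ⟨0, Fin.elim0, fun i => i.elim0, ?_, fun j => j.elim0⟩
    exact algebraicIndependent_empty_type_iff.2 (algebraMap K B).injective
  | succ n ih =>
    by_cases hv : AlgebraicIndependent K v
    · refine ⟨n + 1, v, fun i => Submodule.subset_span ⟨i, rfl⟩, hv, fun j => ?_⟩
      exact isIntegral_algebraMap (R := Algebra.adjoin K (Set.range v))
        (x := ⟨v j, Algebra.subset_adjoin ⟨j, rfl⟩⟩)
    obtain ⟨G, hGv, hG0⟩ : ∃ G : MvPolynomial (Fin (n + 1)) K, aeval v G = 0 ∧ G ≠ 0 := by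
      by_contra! hcon
      exact hv ((injective_iff_map_eq_zero _).2 hcon)
    -- The extra factor `X 0` makes the chosen `c` satisfy `c 0 ≠ 0` as well. The choice is possible
    -- inside `k` because `k` is infinite.
    have htop := mul_ne_zero (homogeneousComponent_totalDegree_ne_zero hG0)
      (X_ne_zero (R := K) (0 : Fin (n + 1)))
    obtain ⟨c, hc⟩ : ∃ c : Fin (n + 1) → k, eval (fun i => algebraMap k K (c i))
        (homogeneousComponent G.totalDegree G * X 0) ≠ 0 := by
      by_contra! hcon
      refine htop (funext_set (fun _ => Set.range (algebraMap k K))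
        (fun _ => Set.infinite_range_of_injective (algebraMap k K).injective) fun x hx => ?_)
      choose c hc using fun i => hx i (Set.mem_univ i)
      have := hcon c
      rw [funext hc] at this
      rw [this, map_zero]
    rw [map_mul, eval_X] at hc
    have hc0 : c 0 ≠ 0 := fun h => right_ne_zero_of_mul hc (by rw [h, map_zero])
    -- With `x = v 0 / c 0` one has `v i = v' i + c i x`, so the relation `G` makes `x` integral
    -- over the `v' i`. As `v' 0 = 0`, only `n` elements remain.
    let v' : Fin (n + 1) → B := fun i => v i - (c i / c 0) • v 0
    obtain ⟨e, U, hUv, hU, hint⟩ := ih fun i => v' i.succ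
    have hv'int : ∀ i, IsIntegral (Algebra.adjoin K (Set.range U)) (v' i) := by
      intro i
      refine Fin.cases ?_ hint i
      have : v' 0 = 0 := by simp [v', div_self hc0]
      rw [this]
      exact isIntegral_zero
    let S := integralClosure (Algebra.adjoin K (Set.range U)) B
    have hx : IsIntegral (Algebra.adjoin K (Set.range U)) ((c 0)⁻¹ • v 0) := by
      have : IsIntegral S ((c 0)⁻¹ • v 0) := by
        refine isIntegral_of_relation (K := K) (fun i => (⟨v' i, hv'int i⟩ : S))
          (fun i => algebraMap k K (c i)) _ (G := G) ?_ ?_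
        · have hvec : (fun i => algebraMap S B ⟨v' i, hv'int i⟩ +
              algebraMap K B (algebraMap k K (c i)) * ((c 0)⁻¹ • v 0)) = v := by
            funext i
            change v' i + _ = _
            simp only [v', ← IsScalarTower.algebraMap_apply, ← Algebra.smul_def, smul_smul,
              div_eq_mul_inv]
            abel
          rw [hvec]
          exact hGv
        · exact left_ne_zero_of_mul hc
      exact isIntegral_trans (A := S) _ this
    refine ⟨e, U, fun i => ?_, hU, fun j => ?_⟩
    · refine (Submodule.span_le.2 ?_ : Submodule.span k _ ≤ _) (hUv i)
      rintro _ ⟨j, rfl⟩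
      exact sub_mem (Submodule.subset_span ⟨_, rfl⟩)
        (Submodule.smul_mem _ _ (Submodule.subset_span ⟨_, rfl⟩))
    · have h1 : v j = v' j + algebraMap (Algebra.adjoin K (Set.range U)) B
          (algebraMap K _ (algebraMap k K (c j))) * ((c 0)⁻¹ • v 0) := by
        simp only [v', ← IsScalarTower.algebraMap_apply, ← Algebra.smul_def, smul_smul,
          div_eq_mul_inv]
        abel
      rw [h1]
      exact (hv'int j).add (isIntegral_algebraMap.mul hx)

end LinearNoether

/-! ### Gauss's lemma for a common root -/

section Gauss

/-- An irreducible polynomial with root `x` divides every polynomial with root `x`. -/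
theorem Irreducible.dvd_of_eval₂_eq_zero {R B : Type*} [CommRing R] [IsDomain R]
    [UniqueFactorizationMonoid R] [CommRing B] [IsDomain B] {φ : R →+* B}
    (hφ : Function.Injective φ) {x : B} {w G : Polynomial R} (hw : Irreducible w)
    (hwx : w.eval₂ φ x = 0) (hGx : G.eval₂ φ x = 0) : w ∣ G := by
  have hdeg : w.natDegree ≠ 0 := by
    intro h
    rw [Polynomial.eq_C_of_natDegree_eq_zero h, Polynomial.eval₂_C] at hwx
    apply hw.ne_zero
    rw [Polynomial.eq_C_of_natDegree_eq_zero h, (map_eq_zero_iff φ hφ).1 hwx, Polynomial.C_0]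
  have hprim := hw.isPrimitive hdeg
  let F := FractionRing R
  let E := FractionRing B
  let ψ : F →+* E := IsFractionRing.map (K := F) (L := E) hφ
  have hψ : ∀ r, ψ (algebraMap R F r) = algebraMap B E (φ r) := fun r => IsLocalization.map_eq _ r
  have hψ' : ψ.comp (algebraMap R F) = (algebraMap B E).comp φ := RingHom.ext hψ
  have hev : ∀ p : Polynomial R, p.eval₂ φ x = 0 →
      (p.map (algebraMap R F)).eval₂ ψ (algebraMap B E x) = 0 := fun p hp => by
    rw [Polynomial.eval₂_map, hψ', ← Polynomial.hom_eval₂, hp, map_zero]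
  refine hprim.dvd_of_fraction_map_dvd_fraction_map (K := F) ?_
  by_contra hndvd
  have hirr := (hprim.irreducible_iff_irreducible_map_fraction_map (K := F)).1 hw
  obtain ⟨a, b, hab⟩ := (hirr.coprime_iff_not_dvd).2 hndvd
  have := congrArg (Polynomial.eval₂ ψ (algebraMap B E x)) hab
  rw [Polynomial.eval₂_add, Polynomial.eval₂_mul, Polynomial.eval₂_mul, hev w hwx, hev G hGx,
    mul_zero, mul_zero, add_zero, Polynomial.eval₂_one] at this
  exact zero_ne_one this

end Gauss

/-! ### Weighted degree of divisors -/

section WeightedDegreeMul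

variable {ι R : Type*} [CommRing R]

/-- The grading substitution `X_i ↦ X_i z ^ {w i}`. -/
noncomputable def gradeSubst (R : Type*) [CommRing R] (w : ι → ℕ) :
    MvPolynomial ι R →ₐ[R] Polynomial (MvPolynomial ι R) :=
  aeval fun i => Polynomial.C (X i) * Polynomial.X ^ w i

theorem gradeSubst_monomial (w : ι → ℕ) (m : ι →₀ ℕ) (r : R) :
    gradeSubst R w (monomial m r) = Polynomial.monomial (Finsupp.weight w m) (monomial m r) := by
  rw [gradeSubst, aeval_monomial, ← Polynomial.C_mul_X_pow_eq_monomial, monomial_eq]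
  simp only [mul_pow, Finsupp.prod, Finset.prod_mul_distrib, ← pow_mul, Finset.prod_pow_eq_pow_sum,
    map_mul, map_prod, map_pow, Polynomial.algebraMap_apply, algebraMap_eq, Finsupp.weight_apply,
    Finsupp.sum, smul_eq_mul, mul_comm (w _), mul_assoc]

theorem mem_wDeg_iff_natDegree_gradeSubst {w : ι → ℕ} {b : ℕ} {p : MvPolynomial ι R} :
    p ∈ wDeg R w 0 b ↔ (gradeSubst R w p).natDegree ≤ b := by
  classical
  constructor
  · intro hp
    conv_lhs => rw [p.as_sum, map_sum]
    refine Polynomial.natDegree_sum_le_of_forall_le _ _ fun m hm => ?_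
    rw [gradeSubst_monomial]
    exact (Polynomial.natDegree_monomial_le _).trans (hp hm)
  · intro hp m hm
    by_contra hlt
    simp only [Set.mem_ofPred_eq, add_zero, not_le] at hlt
    have h1 : (gradeSubst R w p).coeff (Finsupp.weight w m) = 0 :=
      Polynomial.coeff_eq_zero_of_natDegree_lt (hp.trans_lt hlt)
    have h2 : ∀ p : MvPolynomial ι R,
        coeff m ((gradeSubst R w p).coeff (Finsupp.weight w m)) = coeff m p := by
      intro p
      induction p using MvPolynomial.induction_on' with
      | monomial m' r =>
        rw [gradeSubst_monomial, Polynomial.coeff_monomial, coeff_monomial]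
        by_cases h : m' = m
        · subst h
          simp
        · rw [if_neg h]
          split_ifs
          · rw [coeff_monomial, if_neg h]
          · simp
      | add p q hp hq => rw [map_add, Polynomial.coeff_add, coeff_add, coeff_add, hp, hq]
    have h3 := h2 p
    rw [h1, coeff_zero] at h3
    exact mem_support_iff.1 hm h3.symm

/-- The weighted degree is the `z`-degree after the grading substitution, which is additive on
products over a domain. It lets degree bounds pass to irreducible factors. -/
theorem mem_wDeg_of_dvd [IsDomain R] {w : ι → ℕ} {b : ℕ} {p q : MvPolynomial ι R} (hpq : p ∣ q)
    (hq0 : q ≠ 0) (hq : q ∈ wDeg R w 0 b) : p ∈ wDeg R w 0 b := by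
  obtain ⟨r, rfl⟩ := hpq
  rw [mem_wDeg_iff_natDegree_gradeSubst] at hq ⊢
  have hne : ∀ s : MvPolynomial ι R, s ≠ 0 → gradeSubst R w s ≠ 0 := by
    intro s hs h
    apply hs
    have : (Polynomial.aeval (1 : MvPolynomial ι R)).toRingHom.comp (gradeSubst R w).toRingHom =
        RingHom.id _ := by
      refine ringHom_ext (fun c => ?_) fun i => by simp [gradeSubst]
      simp [gradeSubst, Polynomial.algebraMap_apply]
    have h2 := RingHom.congr_fun this s
    simp only [RingHom.comp_apply, RingHom.id_apply] at h2
    rw [← h2]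
    change Polynomial.aeval 1 (gradeSubst R w s) = 0
    rw [h, map_zero]
  rw [map_mul, Polynomial.natDegree_mul (hne _ (left_ne_zero_of_mul hq0))
    (hne _ (right_ne_zero_of_mul hq0))] at hq
  omega

end WeightedDegreeMul

/-! ### Exchanging the order of variables -/

section SwapPolynomial

variable {ι k : Type*} [Field k]

theorem wDeg_le_of_weight_le {R : Type*} [CommRing R] {w w' : ι → ℕ} (h : ∀ i, w' i ≤ w i)
    (b : ℕ) : wDeg R w 0 b ≤ wDeg R w' 0 b := by
  refine restrictSupport_mono R fun m hm => ?_
  simp only [Set.mem_ofPred_eq, Finsupp.weight_apply, add_zero] at hm ⊢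
  exact (Finset.sum_le_sum fun i _ => Nat.mul_le_mul_left _ (h i)).trans hm

/-- The isomorphism `k[t][ι] ≃ k[ι][t]`. -/
noncomputable def swapPolynomial (ι k : Type*) [Field k] :
    MvPolynomial ι (Polynomial k) ≃ₐ[k] Polynomial (MvPolynomial ι k) :=
  (optionEquivRight k ι).symm.trans (optionEquivLeft k ι)

theorem swapPolynomial_X (i : ι) : swapPolynomial ι k (X i) = Polynomial.C (X i) := by
  have : (optionEquivRight k ι).symm (X i) = X (some i) := by
    rw [AlgEquiv.symm_apply_eq, optionEquivRight_X_some]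
  rw [swapPolynomial, AlgEquiv.trans_apply, this, optionEquivLeft_X_some]

theorem swapPolynomial_C (p : Polynomial k) :
    swapPolynomial ι k (C p) = p.map (C : k →+* MvPolynomial ι k) := by
  have h : ((swapPolynomial ι k).toAlgHom.toRingHom.comp C) =
      (Polynomial.mapRingHom (C : k →+* MvPolynomial ι k)) := by
    refine Polynomial.ringHom_ext (fun c => ?_) ?_
    · have : (C (Polynomial.C c) : MvPolynomial ι (Polynomial k)) =
          algebraMap k _ c := rfl
      change swapPolynomial ι k (C (Polynomial.C c)) = Polynomial.map C (Polynomial.C c)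
      rw [this, AlgEquiv.commutes, Polynomial.map_C]
      rfl
    · have : (optionEquivRight k ι).symm (C Polynomial.X) = X none := by
        rw [AlgEquiv.symm_apply_eq, optionEquivRight_X_none]
      simp [swapPolynomial, this]
  exact RingHom.congr_fun h p

theorem coeff_swapPolynomial_monomial (m : ι →₀ ℕ) (p : Polynomial k) (n : ℕ) :
    (swapPolynomial ι k (monomial m p)).coeff n = monomial m (p.coeff n) := by
  have h : swapPolynomial ι k (monomial m 1) = Polynomial.C (monomial m 1) := by
    rw [monomial_eq, monomial_eq]
    simp only [C_1, one_mul, Finsupp.prod, map_prod, map_pow, swapPolynomial_X]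
  rw [← mul_one p, ← C_mul_monomial, map_mul, h, swapPolynomial_C, Polynomial.coeff_mul_C,
    Polynomial.coeff_map, C_mul_monomial, mul_one, mul_one]

theorem coeff_swapPolynomial_mem_wDeg {w : ι → ℕ} {b : ℕ} {p : MvPolynomial ι (Polynomial k)}
    (hp : p ∈ wDeg (Polynomial k) w 0 b) (n : ℕ) :
    (swapPolynomial ι k p).coeff n ∈ wDeg k w 0 b := by
  rw [p.as_sum, map_sum, Polynomial.finsetSum_coeff]
  refine Submodule.sum_mem _ fun m hm => ?_
  rw [coeff_swapPolynomial_monomial]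
  exact monomial_mem_wDeg _ (hp hm)

end SwapPolynomial

/-! ### An irreducible relation of bounded degree -/

section IrreducibleRelation

variable {σ τ : Type} {k : Type*} [Field k]

theorem exists_irreducible_aeval_eq_zero {R A : Type*} [CommRing R] [IsDomain R]
    [UniqueFactorizationMonoid R] [CommRing A] [IsDomain A] (φ : R →+* A) {W : R} (hW : W ≠ 0)
    (h : φ W = 0) : ∃ w, Irreducible w ∧ w ∣ W ∧ φ w = 0 := by
  obtain ⟨s, hs, hsW⟩ := UniqueFactorizationMonoid.exists_prime_factors W hW
  have h0 : φ s.prod = 0 := by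
    obtain ⟨u, rfl⟩ := hsW
    rw [map_mul] at h
    exact (mul_eq_zero.1 h).resolve_right (u.isUnit.map φ).ne_zero
  rw [map_multiset_prod, Multiset.prod_eq_zero_iff, Multiset.mem_map] at h0
  obtain ⟨w, hw, hw0⟩ := h0
  exact ⟨w, (hs w hw).irreducible, (Multiset.dvd_prod hw).trans hsW.dvd, hw0⟩

/-- Perron's theorem over `k(t)` for `#σ + 1` polynomials, the member `none` playing the role of `G`
with `e = d`. After denominators are cleared, some irreducible factor still vanishes, since the
target is a domain. -/
theorem exists_irreducible_relation [Fintype σ] [Fintype τ] {d : ℕ} (hd : 0 < d)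
    {u : Option σ → MvPolynomial (σ ⊕ τ) (Polynomial k)} (hu : ∀ o, (u o).totalDegree ≤ d) :
    ∃ w : MvPolynomial (Option σ ⊕ τ) (Polynomial k), Irreducible w ∧
      w ∈ wDeg (Polynomial k) (Sum.elim (fun _ => 0) fun _ => 1) 0 (d ^ (Fintype.card σ + 1)) ∧
      aeval (Sum.elim u (X ∘ Sum.inr)) w = 0 := by
  classical
  let φ := algebraMap (Polynomial k) (RatFunc k)
  have hφ : Function.Injective φ := IsFractionRing.injective _ _
  have hu' : ∀ o, (map φ (u o)).totalDegree ≤ d := fun o => by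
    rw [← mem_wDeg_one_iff]
    exact map_mem_wDeg φ (mem_wDeg_one_iff.2 (hu o))
  obtain ⟨W, hW0, hWdeg, hW⟩ := exists_perron_relation hd (fun i => hu' (some i)) (hu' none)
  obtain ⟨c, hc, W', hcW⟩ := exists_C_mul_eq_map (A := Polynomial k) W
  have hc' : φ c ≠ 0 := by rwa [Ne, map_eq_zero_iff φ hφ]
  have hW'deg := wDeg_of_C_mul_eq_map hφ hWdeg hcW
  let r : Option (σ ⊕ τ) → Option σ ⊕ τ :=
    fun o => o.elim (Sum.inl none) (Sum.elim (Sum.inl ∘ some) Sum.inr)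
  have hr : Function.Injective r := by
    rintro (_ | _ | _) (_ | _ | _) h <;> simp_all [r]
  have hW'0 : W' ≠ 0 := by
    rintro rfl
    rw [map_zero] at hcW
    exact mul_ne_zero (by simpa [φ] using hc') hW0 hcW
  have hrel : aeval (Sum.elim u (X ∘ Sum.inr)) (rename r W') = 0 := by
    rw [aeval_rename]
    apply map_injective φ hφ
    rw [map_aeval_eq, ← hcW, map_mul, map_zero]
    have hvec : (fun o => map φ ((Sum.elim u (X ∘ Sum.inr) ∘ r) o)) =
        fun o : Option (σ ⊕ τ) => o.elim (map φ (u none))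
          (Sum.elim (fun i => map φ (u (some i))) (X ∘ Sum.inr)) := by
      funext o
      rcases o with _ | _ | _ <;> simp [r]
    rw [hvec, hW, mul_zero]
  obtain ⟨w, hw, hwW, hw0⟩ := exists_irreducible_aeval_eq_zero
    (aeval (Sum.elim u (X ∘ Sum.inr)) : _ →ₐ[Polynomial k] _).toRingHom
    ((map_ne_zero_iff _ (rename_injective r hr)).2 hW'0) hrel
  refine ⟨w, hw, mem_wDeg_of_dvd hwW ((map_ne_zero_iff _ (rename_injective r hr)).2 hW'0) ?_, hw0⟩
  rw [pow_succ']
  -- Only the degree in `y` matters later, so the weight `d` on the other variables is lowered to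
  -- `0`.
  refine wDeg_le_of_weight_le (w := Sum.elim (fun _ => d) fun _ => 1) ?_ _
    (rename_mem_wDeg r ?_ hW'deg)
  · rintro (_ | _) <;> simp
  · rintro (_ | _ | _) <;> simp [r]

end IrreducibleRelation

/-! ### Leading coefficients of irreducible equations of integral elements -/

section LeadingCoeff

variable {σ A K B : Type*} [CommRing A] [IsDomain A] [UniqueFactorizationMonoid A] [Field K]
  [Algebra A K] [IsFractionRing A K] [CommRing B] [IsDomain B] [Algebra K B]

/-- If `x` is integral over `K[U]`, with `U` algebraically independent, then an irreducible
equation of `x` over `A[U]` has its leading coefficient in `A`. -/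
theorem exists_leadingCoeff_eq_C {U : σ → B} (hU : AlgebraicIndependent K U) {x : B}
    (hx : IsIntegral (Algebra.adjoin K (Set.range U)) x) {w : Polynomial (MvPolynomial σ A)}
    (hw : Irreducible w)
    (hwx : w.eval₂ ((aeval U : MvPolynomial σ K →ₐ[K] B).toRingHom.comp
      (map (algebraMap A K))) x = 0) : ∃ h : A, w.leadingCoeff = C h := by
  let φ := (aeval U : MvPolynomial σ K →ₐ[K] B).toRingHom
  have hφ : Function.Injective φ := hU
  have hmap : Function.Injective (map (algebraMap A K) : MvPolynomial σ A →+* _) :=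
    map_injective _ (IsFractionRing.injective A K)
  obtain ⟨g, hg, hgx⟩ := hx
  let G₁ : Polynomial (MvPolynomial σ K) := g.map hU.aevalEquiv.symm.toRingEquiv.toRingHom
  have hG₁ : G₁.Monic := hg.map _
  have hG₁x : G₁.eval₂ φ x = 0 := by
    have heq : φ.comp hU.aevalEquiv.symm.toRingEquiv.toRingHom =
        algebraMap (Algebra.adjoin K (Set.range U)) B := by
      refine RingHom.ext fun y => ?_
      change aeval U (hU.aevalEquiv.symm y) = _
      rw [← hU.algebraMap_aevalEquiv, AlgEquiv.apply_symm_apply]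
    rw [Polynomial.eval₂_map, heq]
    exact hgx
  let _ : Algebra (MvPolynomial σ A) (MvPolynomial σ K) := algebraMvPolynomial
  obtain ⟨_, ⟨c, hc, rfl⟩, hG₂⟩ := IsLocalization.integerNormalization_spec
    ((nonZeroDivisors A).map (C : A →+* MvPolynomial σ A)) G₁
  set G₂ := IsLocalization.integerNormalization
    ((nonZeroDivisors A).map (C : A →+* MvPolynomial σ A)) G₁ with hG₂def
  change G₂.map (map (algebraMap A K)) = _ at hG₂
  have hG₂x : G₂.eval₂ (φ.comp (map (algebraMap A K))) x = 0 :=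
    IsLocalization.integerNormalization_eval₂_eq_zero _ φ G₁ hG₁x
  have hc0 : c ≠ 0 := nonZeroDivisors.ne_zero hc
  have hlc : G₂.leadingCoeff = C c := by
    apply hmap
    rw [← Polynomial.leadingCoeff_map_of_injective hmap, hG₂, Algebra.smul_def]
    change (Polynomial.C (map (algebraMap A K) (C c)) * G₁).leadingCoeff = _
    rw [Polynomial.leadingCoeff_mul_monic hG₁, Polynomial.leadingCoeff_C]
  obtain ⟨G₃, hG₃⟩ := hw.dvd_of_eval₂_eq_zero (φ := φ.comp (map (algebraMap A K)))
    (hφ.comp hmap) hwx hG₂x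
  -- By Gauss `w` divides the monic equation multiplied by its denominator `c`, so its leading
  -- coefficient divides a nonzero constant and has degree `0`.
  have hdvd : w.leadingCoeff ∣ C c := ⟨G₃.leadingCoeff, by
    rw [← hlc, hG₃, Polynomial.leadingCoeff_mul]⟩
  have := totalDegree_le_of_dvd_of_isDomain hdvd (by simpa using hc0)
  rw [totalDegree_C] at this
  exact ⟨_, totalDegree_eq_zero_iff_eq_C.1 (Nat.le_zero.1 this)⟩

end LeadingCoeff

/-! ### Degree of an element of the elimination ideal -/

section EliminationDegree

variable {σ τ β : Type} {k : Type*} [Field k]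

/-- The elements `t f_j` and `x_i` of `k[t][x, y]`. -/
noncomputable def coneGenerators (f : β → MvPolynomial (σ ⊕ τ) k) :
    β ⊕ σ → MvPolynomial (σ ⊕ τ) (Polynomial k) :=
  Sum.elim (fun j => C Polynomial.X * map Polynomial.C (f j)) fun i => X (Sum.inl i)

/-- The embedding of `k[t][x, y]` into `k(y)[t, x]`, where `t` is the variable `none`. -/
noncomputable def coneToFrac (k : Type*) [Field k] (σ τ : Type) :
    MvPolynomial (σ ⊕ τ) (Polynomial k) →ₐ[k]
      MvPolynomial (Option σ) (FractionRing (MvPolynomial τ k)) :=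
  aevalTower (Polynomial.aeval (X none))
    (Sum.elim (fun i => X (some i)) fun j => C (algebraMap (MvPolynomial τ k) _ (X j)))

/-- The reduction of `k[t][x, y]` modulo an ideal of `k[x, y]`. -/
noncomputable def coneToQuotient {ι : Type*} (I : Ideal (MvPolynomial ι k)) :
    MvPolynomial ι (Polynomial k) →ₐ[k] Polynomial (MvPolynomial ι k ⧸ I) :=
  aevalTower (Polynomial.aeval Polynomial.X) fun v => Polynomial.C (Ideal.Quotient.mk I (X v))

theorem coneToFrac_map_C (g : MvPolynomial (σ ⊕ τ) k) :
    coneToFrac k σ τ (map Polynomial.C g) = rename some (toFracX k σ τ g) := by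
  have : (coneToFrac k σ τ).toRingHom.comp (map Polynomial.C) =
      (rename some).toRingHom.comp (toFracX k σ τ).toRingHom := by
    refine ringHom_ext (fun c => ?_) ?_
    · simp [coneToFrac, toFracX, IsScalarTower.algebraMap_apply k
        (FractionRing (MvPolynomial τ k)) (MvPolynomial _ (FractionRing (MvPolynomial τ k)))]
    · rintro (i | j) <;> simp [coneToFrac, toFracX]
  exact RingHom.congr_fun this g

theorem coneToQuotient_map_C {ι : Type*} (I : Ideal (MvPolynomial ι k)) (g : MvPolynomial ι k) :
    coneToQuotient I (map Polynomial.C g) = Polynomial.C (Ideal.Quotient.mk I g) := by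
  have : (coneToQuotient I).toRingHom.comp (map Polynomial.C) =
      Polynomial.C.comp (Ideal.Quotient.mk I) := by
    refine ringHom_ext (fun c => ?_) fun i => by simp [coneToQuotient]
    simp [coneToQuotient]
    rfl
  exact RingHom.congr_fun this g

theorem totalDegree_le_of_mem_span_coneGenerators {d : ℕ} (hd : 0 < d)
    {f : β → MvPolynomial (σ ⊕ τ) k} (hf : ∀ i, (f i).totalDegree ≤ d)
    {u : MvPolynomial (σ ⊕ τ) (Polynomial k)}
    (hu : u ∈ Submodule.span k (Set.range (coneGenerators f))) : u.totalDegree ≤ d := by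
  have : Submodule.span k (Set.range (coneGenerators f)) ≤
      (wDeg (Polynomial k) (fun _ => 1) 0 d).restrictScalars k := by
    rw [Submodule.span_le]
    rintro _ ⟨j | i, rfl⟩
    · rw [SetLike.mem_coe, Submodule.restrictScalars_mem]
      change C Polynomial.X * map Polynomial.C (f j) ∈ _
      rw [← smul_eq_C_mul]
      exact Submodule.smul_mem _ _ (map_mem_wDeg _ (mem_wDeg_one_iff.2 (hf j)))
    · rw [SetLike.mem_coe, Submodule.restrictScalars_mem]
      exact mem_wDeg_one_iff.2 ((totalDegree_X _).le.trans hd)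
  exact mem_wDeg_one_iff.1 (this hu)

/-- Modulo `I` the generators `t f_j` vanish and the `x_i` do not involve `t`. -/
theorem coneToQuotient_eq_C_of_mem_span {f : β → MvPolynomial (σ ⊕ τ) k}
    {u : MvPolynomial (σ ⊕ τ) (Polynomial k)}
    (hu : u ∈ Submodule.span k (Set.range (coneGenerators f))) :
    ∃ c, coneToQuotient (Ideal.span (Set.range f)) u = Polynomial.C c := by
  have : Submodule.span k (Set.range (coneGenerators f)) ≤
      (LinearMap.range (Polynomial.CAlgHom (R := k) (A := MvPolynomial (σ ⊕ τ) k ⧸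
        Ideal.span (Set.range f))).toLinearMap).comap
        (coneToQuotient (Ideal.span (Set.range f))).toLinearMap := by
    rw [Submodule.span_le]
    rintro _ ⟨j | i, rfl⟩
    · refine ⟨0, ?_⟩
      have hz : Ideal.Quotient.mk (Ideal.span (Set.range f)) (f j) = 0 :=
        Ideal.Quotient.eq_zero_iff_mem.2 (Ideal.subset_span ⟨j, rfl⟩)
      change Polynomial.C 0 =
        coneToQuotient (Ideal.span (Set.range f)) (C Polynomial.X * map Polynomial.C (f j))
      rw [map_mul, coneToQuotient_map_C, hz, map_zero, mul_zero]
    · refine ⟨Ideal.Quotient.mk _ (X (Sum.inl i)), ?_⟩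
      simp [coneGenerators, coneToQuotient]
  obtain ⟨c, hc⟩ := this hu
  exact ⟨c, hc.symm⟩

/-- Writing `g = ∑ a_j f_j` and dividing by `g`, a unit of `k(y)`, gives `t = g⁻¹ ∑ a_j (t f_j)`.
Thus `t` belongs to the algebra generated by the `t f_j` and `x_i`. -/
theorem eq_top_of_coneToFrac_coneGenerators_mem [Fintype β]
    {f : β → MvPolynomial (σ ⊕ τ) k} {g : MvPolynomial τ k} (hg : g ≠ 0)
    (hgf : rename Sum.inr g ∈ Ideal.span (Set.range f))
    {S : Subalgebra (FractionRing (MvPolynomial τ k))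
      (MvPolynomial (Option σ) (FractionRing (MvPolynomial τ k)))}
    (hgen : ∀ j, coneToFrac k σ τ (coneGenerators f j) ∈ S) : S = ⊤ := by
  have hX : ∀ i, X (some i) ∈ S := fun i => by
    have h : coneToFrac k σ τ (coneGenerators f (Sum.inr i)) = X (some i) := by
      simp [coneToFrac, coneGenerators]
    exact h ▸ hgen (Sum.inr i)
  have hrename : ∀ p : MvPolynomial σ (FractionRing (MvPolynomial τ k)), rename some p ∈ S :=
    fun p => by
      induction p using MvPolynomial.induction_on with
      | C a => rw [rename_C]; exact S.algebraMap_mem a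
      | add p q hp hq => rw [map_add]; exact S.add_mem hp hq
      | mul_X p i hp => rw [map_mul, rename_X]; exact S.mul_mem hp (hX i)
  have hg' : algebraMap (MvPolynomial τ k) (FractionRing (MvPolynomial τ k)) g ≠ 0 := by
    rwa [Ne, FaithfulSMul.algebraMap_eq_zero_iff]
  have hnone : X none ∈ S := by
    obtain ⟨a, ha⟩ := (Ideal.mem_span_range_iff_exists_fun).1 hgf
    have h1 : ∑ j, rename some (toFracX k σ τ (a j)) *
        coneToFrac k σ τ (coneGenerators f (Sum.inl j)) = X none *
          C (algebraMap (MvPolynomial τ k) (FractionRing (MvPolynomial τ k)) g) := by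
      have h2 := congrArg (fun p => rename (some : σ → Option σ) (toFracX k σ τ p)) ha
      simp only [toFracX_rename_inr, map_sum, map_mul, rename_C] at h2
      rw [← h2, Finset.mul_sum]
      refine Finset.sum_congr rfl fun j _ => ?_
      have h3 : coneToFrac k σ τ (coneGenerators f (Sum.inl j)) =
          X none * rename some (toFracX k σ τ (f j)) := by
        change coneToFrac k σ τ (C Polynomial.X * map Polynomial.C (f j)) = _
        rw [map_mul, coneToFrac_map_C]
        simp [coneToFrac]
      rw [h3, mul_left_comm]
    have h4 : X none = C (algebraMap (MvPolynomial τ k) (FractionRing (MvPolynomial τ k)) g)⁻¹ *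
        ∑ j, rename some (toFracX k σ τ (a j)) *
          coneToFrac k σ τ (coneGenerators f (Sum.inl j)) := by
      rw [h1, mul_left_comm, ← C_mul, inv_mul_cancel₀ hg', C_1, mul_one]
    rw [h4]
    exact S.mul_mem (S.algebraMap_mem _)
      (S.sum_mem fun j _ => S.mul_mem (hrename _) (hgen _))
  rw [eq_top_iff, ← adjoin_range_X, Algebra.adjoin_le_iff]
  rintro _ ⟨_ | i, rfl⟩
  · exact hnone
  · exact hX i

/-- Normalization coefficients are taken in `k` rather than `k(y)`, so that the new elements stay in
`k[t][x, y]` with degree at most `d`. Their number is the transcendence degree of `k(y)[t, x]`,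
namely `#σ + 1`. -/
theorem exists_noether_system [Infinite k] [Fintype σ] [Fintype β]
    {f : β → MvPolynomial (σ ⊕ τ) k} {g : MvPolynomial τ k} (hg : g ≠ 0)
    (hgf : rename Sum.inr g ∈ Ideal.span (Set.range f)) :
    ∃ u : Option σ → MvPolynomial (σ ⊕ τ) (Polynomial k),
      (∀ o, u o ∈ Submodule.span k (Set.range (coneGenerators f))) ∧
      AlgebraicIndependent (FractionRing (MvPolynomial τ k)) (fun o => coneToFrac k σ τ (u o)) ∧
      IsIntegral (Algebra.adjoin (FractionRing (MvPolynomial τ k))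
        (Set.range fun o => coneToFrac k σ τ (u o)))
        (X none : MvPolynomial (Option σ) (FractionRing (MvPolynomial τ k))) := by
  classical
  let K := FractionRing (MvPolynomial τ k)
  let B := MvPolynomial (Option σ) K
  let Θ := coneToFrac k σ τ
  let ε := Fintype.equivFin (β ⊕ σ)
  obtain ⟨e, U, hUv, hU, hint⟩ := exists_linear_noether_normalization (k := k) (K := K) (B := B) _
    fun n => Θ (coneGenerators f (ε.symm n))
  let S := integralClosure (Algebra.adjoin K (Set.range U)) B
  have hgen : ∀ j, Θ (coneGenerators f j) ∈ S := fun j => by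
    have h := hint (ε j)
    rwa [Equiv.symm_apply_apply] at h
  have hall : ∀ p : B, IsIntegral (Algebra.adjoin K (Set.range U)) p := fun p => by
    have h := eq_top_of_coneToFrac_coneGenerators_mem hg hgf (S := S.restrictScalars K) hgen
    have hp : p ∈ S.restrictScalars K := h ▸ Algebra.mem_top
    exact hp
  have hbasis : IsTranscendenceBasis K U := hU.isTranscendenceBasis_iff_isAlgebraic.2
    ⟨fun p => (hall p).isAlgebraic⟩
  have hcard := hbasis.lift_cardinalMk_eq (IsTranscendenceBasis.mvPolynomial (Option σ) K)
  let η : Option σ ≃ Fin e := (Cardinal.lift_mk_eq'.1 hcard).some.symm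
  have hspan : ∀ o, ∃ u ∈ Submodule.span k (Set.range (coneGenerators f)), Θ u = U (η o) := by
    intro o
    have h1 := hUv (η o)
    have h2 : Set.range (fun n => Θ (coneGenerators f (ε.symm n))) =
        Θ.toLinearMap '' Set.range (coneGenerators f) := by
      rw [← Set.range_comp]
      exact ε.symm.surjective.range_comp fun j => Θ (coneGenerators f j)
    rw [h2, ← Submodule.map_span] at h1
    exact h1
  choose u hu hΘu using hspan
  refine ⟨u, hu, ?_, ?_⟩
  · have : (fun o => coneToFrac k σ τ (u o)) = U ∘ η := funext hΘu
    rw [this]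
    exact hU.comp _ η.injective
  · have : (Set.range fun o => coneToFrac k σ τ (u o)) = Set.range U := by
      rw [← η.surjective.range_comp U]
      exact congrArg Set.range (funext hΘu)
    rw [this]
    exact hall _

/-- If `⟨f⟩` meets `k[y]` nontrivially, then it contains a nonzero polynomial in `y` of degree
at most `d ^ (q + 1)`. -/
theorem exists_totalDegree_le_rename_mem_span [Infinite k] [Fintype σ] [Fintype τ] [Fintype β]
    {d : ℕ} (hd : 0 < d) {f : β → MvPolynomial (σ ⊕ τ) k} (hf : ∀ i, (f i).totalDegree ≤ d)
    {g : MvPolynomial τ k} (hg : g ≠ 0) (hgf : rename Sum.inr g ∈ Ideal.span (Set.range f)) :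
    ∃ h : MvPolynomial τ k, h ≠ 0 ∧ rename Sum.inr h ∈ Ideal.span (Set.range f) ∧
      h.totalDegree ≤ d ^ (Fintype.card σ + 1) := by
  classical
  let K := FractionRing (MvPolynomial τ k)
  let I := Ideal.span (Set.range f)
  obtain ⟨u, hu, hU, hint⟩ := exists_noether_system hg hgf
  obtain ⟨w, hw, hwdeg, hwu⟩ := exists_irreducible_relation hd fun o =>
    totalDegree_le_of_mem_span_coneGenerators hd hf (hu o)
  choose c hc using fun o => coneToQuotient_eq_C_of_mem_span (hu o)
  let Ψ : MvPolynomial (Option σ ⊕ τ) (Polynomial k) →+* MvPolynomial (σ ⊕ τ) (Polynomial k) :=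
    (aeval (Sum.elim u (X ∘ Sum.inr)) : _ →ₐ[Polynomial k] _).toRingHom
  let w₁ := swapPolynomial (Option σ ⊕ τ) k w
  let s := sumAlgEquiv k (Option σ) τ
  let w₂ : Polynomial (MvPolynomial (Option σ) (MvPolynomial τ k)) :=
    Polynomial.mapEquiv s.toRingEquiv w₁
  have hw₂ : Irreducible w₂ := by
    rw [MulEquiv.irreducible_iff, MulEquiv.irreducible_iff]
    exact hw
  let φ := (aeval (fun o => coneToFrac k σ τ (u o)) : _ →ₐ[K] _).toRingHom.comp
    (map (algebraMap (MvPolynomial τ k) K) : MvPolynomial (Option σ) (MvPolynomial τ k) →+* _)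
  -- Read as a polynomial in `t` over `k[y][U]`, the relation is an equation for `t` over the
  -- normalization.
  have hw₂0 : w₂.eval₂ φ (X none) = 0 := by
    have h : ((Polynomial.eval₂RingHom φ (X none)).comp
        (Polynomial.mapRingHom s.toRingEquiv.toRingHom)).comp
        (swapPolynomial (Option σ ⊕ τ) k).toRingEquiv.toRingHom =
        (coneToFrac k σ τ).toRingHom.comp Ψ := by
      refine ringHom_ext' (Polynomial.ringHom_ext (fun a => ?_) ?_) ?_
      · simp [swapPolynomial_C]
        have h1 : s (C a) = C (C a) := s.commutes a
        rw [h1]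
        simp [Ψ, φ, coneToFrac]
        rfl
      · simp [swapPolynomial_C, Ψ, coneToFrac]
      · rintro (o | j)
        · simp [swapPolynomial_X, Ψ, φ, s]
        · simp [swapPolynomial_X, Ψ, φ, s, coneToFrac]
          rfl
    have h2 := RingHom.congr_fun h w
    rw [RingHom.comp_apply, RingHom.comp_apply] at h2
    refine h2.trans ?_
    change coneToFrac k σ τ (aeval _ w) = 0
    rw [hwu, map_zero]
  obtain ⟨h, hh⟩ := exists_leadingCoeff_eq_C hU hint hw₂ hw₂0
  have hlc : w₁.leadingCoeff = rename Sum.inr h := by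
    apply s.injective
    have h1 : s w₁.leadingCoeff = w₂.leadingCoeff :=
      (Polynomial.leadingCoeff_map_of_injective (f := s.toRingEquiv.toRingHom) s.injective w₁).symm
    rw [h1, hh]
    exact (DFunLike.congr_fun (sumAlgEquiv_comp_rename_inr k (Option σ) τ) h).symm
  refine ⟨h, ?_, ?_, ?_⟩
  · rintro rfl
    rw [C_0, Polynomial.leadingCoeff_eq_zero] at hh
    exact hw₂.ne_zero hh
  · let ρ : MvPolynomial (Option σ ⊕ τ) k →ₐ[k] MvPolynomial (σ ⊕ τ) k ⧸ I :=
      aeval (Sum.elim c fun j => Ideal.Quotient.mk I (X (Sum.inr j)))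
    have h1 : (Polynomial.mapRingHom ρ.toRingHom).comp
        (swapPolynomial (Option σ ⊕ τ) k).toRingEquiv.toRingHom =
        (coneToQuotient I).toRingHom.comp Ψ := by
      refine ringHom_ext' (Polynomial.ringHom_ext (fun a => ?_) ?_) ?_
      · simp [swapPolynomial_C]
        simp [Ψ, coneToQuotient]
      · simp [swapPolynomial_C, Ψ, coneToQuotient]
      · rintro (o | j)
        · simp [swapPolynomial_X, Ψ, ρ, ← hc, I]
        · simp [swapPolynomial_X, Ψ, ρ, coneToQuotient]
    -- Modulo `I` the elements `u` become the constants `c`, free of `t`. The relation is then the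
    -- zero polynomial in `t`, and its coefficient in the top degree of `w₁` says `h ∈ I`.
    have h2 : w₁.map ρ.toRingHom = 0 := by
      refine (RingHom.congr_fun h1 w).trans ?_
      change coneToQuotient I (aeval _ w) = 0
      rw [hwu, map_zero]
    have h3 := congrArg (fun p => p.coeff w₁.natDegree) h2
    simp only [Polynomial.coeff_map, Polynomial.coeff_zero, Polynomial.coeff_natDegree, hlc] at h3
    rw [← Ideal.Quotient.eq_zero_iff_mem, ← h3]
    have h4 : (Ideal.Quotient.mkₐ k I).comp (rename Sum.inr) = ρ.comp (rename Sum.inr) := by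
      ext j
      simp [ρ]
    exact DFunLike.congr_fun h4 h
  · have h1 := totalDegree_coeff_sumAlgEquiv_le (coeff_swapPolynomial_mem_wDeg hwdeg w₁.natDegree) 0
    have h2 : sumAlgEquiv k (Option σ) τ ((swapPolynomial (Option σ ⊕ τ) k w).coeff w₁.natDegree) =
        C h := by
      change s w₁.leadingCoeff = _
      rw [hlc]
      exact DFunLike.congr_fun (sumAlgEquiv_comp_rename_inr k (Option σ) τ) h
    rwa [h2, coeff_C, if_pos rfl] at h1

end EliminationDegree

/-! ### The probabilistic estimate -/

section SchwartzZippel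

open MeasureTheory ProbabilityTheory

/-- The **Schwartz–Zippel lemma** for independent uniformly distributed points. -/
theorem one_sub_totalDegree_div_card_le_measureReal {k : Type*} [Field k] [MeasurableSpace k]
    [MeasurableSingletonClass k] {r : ℕ} {h : MvPolynomial (Fin r) k} (hh : h ≠ 0) {S : Finset k}
    (hS : S.Nonempty) {Ω : Type*} [MeasurableSpace Ω] {P : Measure Ω} [IsProbabilityMeasure P]
    {a : Fin r → Ω → k} (ha : ∀ j, HasLaw (a j) (uniformOn (S : Set k)) P)
    (hindep : iIndepFun a P) :
    1 - (h.totalDegree : ℝ) / S.card ≤ P.real {ω | eval (fun j => a j ω) h ≠ 0} := by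
  classical
  have hcard : (S.card : ℝ) ≠ 0 := by exact_mod_cast hS.card_ne_zero
  let bad := (Fintype.piFinset fun _ : Fin r => S).filter fun b => eval b h = 0
  have hmem : ∀ j, ∀ c ∈ S, P (a j ⁻¹' {c}) = (S.card : ENNReal)⁻¹ := by
    intro j c hc
    have h1 := (ha j).measure_eq (p := fun x => x ∈ ({c} : Finset k))
      (Finset.measurableSet {c})
    have h2 : {x | x ∈ ({c} : Finset k)} = (({c} : Finset k) : Set k) := rfl
    rw [h2, uniformOn_apply_finset, Finset.inter_singleton_of_mem hc] at h1
    simpa [Set.preimage] using h1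
  have hnot : ∀ j, P {ω | a j ω ∉ S} = 0 := by
    intro j
    rw [(ha j).measure_eq (p := fun x => x ∉ S) S.measurableSet.compl,
      uniformOn_eq_zero_iff S.finite_toSet]
    ext x
    simp
  have hpoint : ∀ b ∈ bad, P.real {ω | (fun j => a j ω) = b} = ((S.card : ℝ) ^ r)⁻¹ := by
    intro b hb
    have h1 : {ω | (fun j => a j ω) = b} = ⋂ j ∈ Finset.univ, a j ⁻¹' {b j} := by
      ext ω
      simp [funext_iff]
    rw [measureReal_def, h1, hindep.measure_inter_preimage_eq_mul Finset.univ
      fun j _ => measurableSet_singleton (b j),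
      Finset.prod_congr rfl fun j _ => hmem j (b j)
        (Fintype.mem_piFinset.1 (Finset.mem_filter.1 hb).1 j)]
    simp
  -- Union bound: either `h` does not vanish, or the point is a zero of `h` in the grid `S ^ r`,
  -- each hit with probability `|S| ^ (-r)`, or it leaves the grid, a null event.
  have hcover : (Set.univ : Set Ω) ⊆ {ω | eval (fun j => a j ω) h ≠ 0} ∪
      ((⋃ b ∈ bad, {ω | (fun j => a j ω) = b}) ∪ ⋃ j, {ω | a j ω ∉ S}) := by
    intro ω _
    by_cases h1 : eval (fun j => a j ω) h = 0
    · right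
      by_cases h2 : ∀ j, a j ω ∈ S
      · left
        exact Set.mem_biUnion (Finset.mem_coe.2 (Finset.mem_filter.2
          ⟨Fintype.mem_piFinset.2 h2, h1⟩)) rfl
      · right
        push Not at h2
        exact Set.mem_iUnion.2 h2
    · exact Or.inl h1
  have hnull : P.real (⋃ j, {ω | a j ω ∉ S}) = 0 := by
    rw [measureReal_def, measure_iUnion_null hnot, ENNReal.toReal_zero]
  have hbad : P.real (⋃ b ∈ bad, {ω | (fun j => a j ω) = b}) ≤ h.totalDegree / S.card := by
    refine (measureReal_biUnion_finset_le _ _).trans ?_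
    rw [Finset.sum_congr rfl hpoint, Finset.sum_const, nsmul_eq_mul, ← div_eq_mul_inv]
    have hSZ := (NNRat.cast_le (K := ℝ)).2 (schwartz_zippel_totalDegree hh S)
    push_cast at hSZ
    exact hSZ
  have h1 := (measureReal_mono hcover (measure_ne_top P _)).trans (measureReal_union_le _ _)
  have h2 := measureReal_union_le (μ := P) (⋃ b ∈ bad, {ω | (fun j => a j ω) = b})
    (⋃ j, {ω | a j ω ∉ S})
  rw [probReal_univ] at h1
  linarith

end SchwartzZippel

/-! ### Combining the two cases -/

section Main

theorem mem_polyY_iff {k : Type*} [Field k] {q r : ℕ} {x : PolyXY k q r} :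
    x ∈ polyY k q r ↔ ∃ p : MvPolynomial (Fin r) k, rename Sum.inr p = x := by
  rw [polyY, Algebra.adjoin_range_eq_range_aeval, AlgHom.mem_range]
  have h : rename Sum.inr = aeval (R := k) fun j : Fin r => (X (Sum.inr j) : PolyXY k q r) := by
    ext j : 1
    simp
  rw [h]

theorem inter_polyY_ne_iff {k : Type*} [Field k] {q r : ℕ} (I : Ideal (PolyXY k q r)) :
    (I : Set (PolyXY k q r)) ∩ (polyY k q r : Set (PolyXY k q r)) ≠ {0} ↔
      ∃ p : MvPolynomial (Fin r) k, p ≠ 0 ∧ rename Sum.inr p ∈ I := by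
  rw [← not_iff_not, not_not]
  push Not
  constructor
  · intro h p hp hpI
    have : rename Sum.inr p ∈ ({0} : Set (PolyXY k q r)) := h ▸ ⟨hpI, mem_polyY_iff.2 ⟨p, rfl⟩⟩
    exact hp ((map_eq_zero_iff _ (rename_injective _ Sum.inr_injective)).1 this)
  · intro h
    refine Set.Subset.antisymm ?_ (Set.singleton_subset_iff.2 ⟨I.zero_mem, zero_mem _⟩)
    rintro _ ⟨hI, hx⟩
    obtain ⟨p, rfl⟩ := mem_polyY_iff.1 hx
    by_contra hne
    exact h p (fun hp => hne (by rw [hp, map_zero]; rfl)) hI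

/-- Outside a hypersurface of degree at most `d ^ (q + r)`, specialization detects whether the
ideal meets `k[y]`. -/
theorem exists_forall_eval_ne_zero_elimination_iff {k : Type*} [Field k] [Infinite k]
    {q r l d : ℕ} (hd : r ≠ 0 → 0 < d) {f : Fin l → PolyXY k q r}
    (hf : ∀ i, (f i).totalDegree ≤ d) :
    ∃ h : MvPolynomial (Fin r) k, h ≠ 0 ∧ (r ≠ 0 → h.totalDegree ≤ d ^ (q + r)) ∧
      ∀ a : Fin r → k, eval a h ≠ 0 →
        ((Ideal.span (Set.range f) : Set (PolyXY k q r)) ∩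
            (polyY k q r : Set (PolyXY k q r)) ≠ {0} ↔
          (1 : MvPolynomial (Fin q) k) ∈
            Ideal.span (Set.range fun i => specializeY a (f i))) := by
  rw [inter_polyY_ne_iff]
  -- The degree lemmas need a positive degree bound. The case `d = 0` occurs only for `r = 0`, where
  -- no bound on `h` is required.
  have hmax : 0 < max d 1 := by omega
  have hf' : ∀ i, (f i).totalDegree ≤ max d 1 := fun i => (hf i).trans (le_max_left _ _)
  have hdeg : ∀ n, n ≤ q + r → r ≠ 0 → max d 1 ^ n ≤ d ^ (q + r) := fun n hn hr => by
    rw [max_eq_left (hd hr)]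
    exact Nat.pow_le_pow_right (hd hr) hn
  by_cases hex : ∃ p : MvPolynomial (Fin r) k, p ≠ 0 ∧ rename Sum.inr p ∈ Ideal.span (Set.range f)
  · obtain ⟨g, hg, hgf⟩ := hex
    obtain ⟨h, hh, hhf, hhd⟩ := exists_totalDegree_le_rename_mem_span hmax hf' hg hgf
    rw [Fintype.card_fin] at hhd
    -- The exponent `q + 1` is at most `q + r` exactly because `r ≠ 0`.
    refine ⟨h, hh, fun hr => hhd.trans (hdeg _ (by omega) hr), fun a ha =>
      iff_of_true ⟨g, hg, hgf⟩ ?_⟩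
    have h1 := Ideal.mem_map_of_mem (specializeY a) hhf
    rw [Ideal.map_span, ← Set.range_comp] at h1
    have h2 : specializeY a (rename Sum.inr h : PolyXY k q r) = C (eval a h) := by
      have h3 : (specializeY a).comp (rename Sum.inr) =
          (Algebra.ofId k (MvPolynomial (Fin q) k)).comp (aeval a) := by
        ext j
        simp [specializeY, Algebra.ofId_apply]
      exact DFunLike.congr_fun h3 h
    rw [h2] at h1
    have h4 := Ideal.mul_mem_left _ (C (eval a h)⁻¹) h1
    rwa [← C_mul, inv_mul_cancel₀ ha, C_1] at h4
  · obtain ⟨h, hh, hhd, hha⟩ := exists_totalDegree_le_one_notMem_span hmax q (Fin q) (Fin r)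
      (Fintype.card_fin q) f hf' fun p hp => by
        by_contra hne
        exact hex ⟨p, hne, hp⟩
    exact ⟨h, hh, fun hr => hhd.trans (hdeg _ (by omega) hr), fun a ha => iff_of_false hex (hha a ha)⟩

end Main

theorem mainTheorem8 {k : Type*} [Field k] [CharZero k]
    [MeasurableSpace k] [MeasurableSingletonClass k]
    (q r l d : ℕ) (f : Fin l → PolyXY k q r) (hf : ∀ i, (f i).totalDegree ≤ d)
    (p : ℝ) (hp0 : 0 < p) (hp1 : p < 1)
    (S : Finset k) (hS : S.card = ⌈(d : ℝ) ^ (q + r) / (1 - p)⌉₊)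
    {Ω : Type*} [MeasurableSpace Ω] (P : MeasureTheory.Measure Ω)
    [MeasureTheory.IsProbabilityMeasure P] (a : Fin r → Ω → k)
    (ha_unif : ∀ j, ProbabilityTheory.HasLaw (a j)
      (ProbabilityTheory.uniformOn (S : Set k)) P)
    (ha_indep : ProbabilityTheory.iIndepFun a P) :
    p ≤ P.real {ω |
      (Ideal.span (Set.range f) : Set (PolyXY k q r)) ∩ (polyY k q r : Set (PolyXY k q r)) ≠ {0} ↔
        (1 : MvPolynomial (Fin q) k) ∈
          Ideal.span (Set.range fun i => specializeY (fun j => a j ω) (f i))} := by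
  -- For empty `S` the uniform law is the zero measure, which is not the law of a random variable.
  -- Nonemptiness then forces `d > 0`, since `d = 0` with `r ≠ 0` gives `|S| = 0`.
  have hSne : r ≠ 0 → S.Nonempty := by
    intro hr
    by_contra hempty
    have hmap := (ha_unif ⟨0, Nat.pos_of_ne_zero hr⟩).isProbabilityMeasure_iff.1 inferInstance
    rw [Finset.not_nonempty_iff_eq_empty.1 hempty, Finset.coe_empty,
      ProbabilityTheory.uniformOn_empty_meas] at hmap
    exact MeasureTheory.IsProbabilityMeasure.ne_zero (0 : MeasureTheory.Measure k) rfl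
  have hd : r ≠ 0 → 0 < d := by
    intro hr
    rw [Nat.pos_iff_ne_zero]
    rintro rfl
    have h0 := (hSne hr).card_ne_zero
    rw [hS, Nat.cast_zero, zero_pow (by omega), zero_div, Nat.ceil_zero] at h0
    exact h0 rfl
  obtain ⟨h, hh, hhd, hha⟩ := exists_forall_eval_ne_zero_elimination_iff hd hf
  refine le_trans ?_ (MeasureTheory.measureReal_mono (μ := P)
    (fun ω hω => hha (fun j => a j ω) hω) (MeasureTheory.measure_ne_top P _))
  -- Without parameters `h` is a nonzero constant, so the equivalence holds surely.
  rcases eq_or_ne r 0 with rfl | hr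
  · have huniv : {ω | eval (fun j => a j ω) h ≠ 0} = Set.univ := by
      refine Set.eq_univ_of_forall fun ω h0 => hh ?_
      rw [eq_C_of_isEmpty h, eval_C] at h0
      rw [eq_C_of_isEmpty h, h0, C_0]
    change p ≤ P.real {ω | eval (fun j => a j ω) h ≠ 0}
    rw [huniv, MeasureTheory.probReal_univ]
    exact hp1.le
  · refine le_trans ?_ (one_sub_totalDegree_div_card_le_measureReal hh (hSne hr) ha_unif ha_indep)
    have hpos : (0 : ℝ) < S.card := by exact_mod_cast (hSne hr).card_pos
    have hle : (d : ℝ) ^ (q + r) / (1 - p) ≤ S.card := by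
      rw [hS]
      exact Nat.le_ceil _
    have hdeg : (h.totalDegree : ℝ) ≤ (d : ℝ) ^ (q + r) := by exact_mod_cast hhd hr
    have h1p : 0 < 1 - p := by linarith
    rw [div_le_iff₀ h1p] at hle
    have : (h.totalDegree : ℝ) / S.card ≤ 1 - p := by
      rw [div_le_iff₀ hpos]
      linarith
    linarith
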